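/- Let $R$ be a commutative noetherian ring, let $M$ be a finitely generated $R$-module, and put $S=\mathrm{End}_R(M)$. Notation. $\mathrm{add}(M)$ (resp. $\mathrm{Add}(M)$) is the class of modules isomorphic to a direct summand of a finite (resp. arbitrary) direct sum of copies of $M$. $V(M)$ is the monoid, under direct sum, of isomorphism classes of modules in $\mathrm{add}(M)$, and $V^*(M)\supseteq V(M)$ is the monoid of isomorphism classes of countably generated modules in $\mathrm{Add}(M)$. The same notation is used for right modules over other rings; $V(S/I)$ is the monoid of isomorphism classes of finitely generated projective right $S/I$-modules, and $V^*(S)$ that of countably generated projective right $S$-modules. The trace of a projective right $S$-module $P$ is the ideal $\mathrm{Tr}_S(P)=\sum_{f\in \mathrm{Hom}_S(P,S)}f(P)$, and $\mathcal T(S)$ is the set of traces of countably generated projective right $S$-modules. A countably generated projective right $S$-module $P$ is $I$-big, for an ideal $I$, if every countably generated projective right $S$-module $Q$ with $QI=Q$ is a homomorphic image of $P$. For $I\in\mathcal T(S)$, the map $\iota_I\colon V(S/I)\to V^*(S)$ sends $[P']$ to $[P]$, where $P$ is a countably generated projective $I$-big right $S$-module with $P/PI\cong P'$, and $\alpha_I\colon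 V(S/I)\to V^*(M)$ is $\iota_I$ followed by the inverse of the isomorphism $V^*(M)\to V^*(S)$, $[X]\mapsto[\mathrm{Hom}_R(M,X)]$. Finally, $B(M)=\bigcup_{0\ne I\in\mathcal T(S)}\alpha_I(V(S/I))$. Then: 1. $V^*(M)=V(M)\sqcup B(M)$, that is, $V^*(M)=V(M)\cup B(M)$ and $V(M)\cap B(M)=\emptyset$. 2. For every countably generated module $X$ in $\mathrm{Add}(M)$ there are exactly one trace ideal $I\in\mathcal T(S)$ and exactly one class $[P']\in V(S/I)$ such that $[X]=\alpha_I([P'])$; and for every $I\in\mathcal T(S)$ and $[P']\in V(S/I)$ there is exactly one class $\alpha_I([P'])$ in $V^*(M)$ as described (in particular, $\alpha_I$ is well defined). Thus $X$ is determined up to isomorphism by the pair $(I,[P'])$, and every such pair occurs. -/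

import Mathlib

universe u v

/-! ### Isomorphism classes of modules

Conventions. Over a noncommutative ring `A`, "module" means left module, as in Mathlib. Right modules
over a ring `S` are modules over the opposite ring of `S`; the two rings have the same two-sided ideals,
and the opposite of `S / I` is the quotient of the opposite of `S` by `I`. -/

/-- `N` is isomorphic to a direct summand of `L`: there are maps `N → L → N` composing to the identity. -/
def IsSummand (A : Type v) [Ring A] (N L : Type u) [AddCommGroup N] [Module A N]
    [AddCommGroup L] [Module A L] : Prop :=
  ∃ (i : N →ₗ[A] L) (p : L →ₗ[A] N), p ∘ₗ i = LinearMap.id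

/-- The module `N` has a countable generating set. -/
def IsCountablyGen (A : Type v) [Ring A] (N : Type u) [AddCommGroup N] [Module A N] : Prop :=
  ∃ s : Set N, s.Countable ∧ Submodule.span A s = ⊤

/-- `N` belongs to `add(M)`: it is isomorphic to a direct summand of a finite direct sum of copies
of `M`. -/
def MemFinAdd (A : Type v) [Ring A] (M N : Type u) [AddCommGroup M] [Module A M]
    [AddCommGroup N] [Module A N] : Prop :=
  ∃ n : ℕ, IsSummand A N (Fin n → M)

/-- `N` belongs to `Add(M)`: it is isomorphic to a direct summand of an arbitrary direct sum of copies
of `M`. -/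
def MemAdd (A : Type v) [Ring A] (M N : Type u) [AddCommGroup M] [Module A M]
    [AddCommGroup N] [Module A N] : Prop :=
  ∃ ι : Type u, IsSummand A N (ι →₀ M)

theorem IsSummand.prod {A : Type v} [Ring A] {N₁ N₂ L₁ L₂ L : Type u}
    [AddCommGroup N₁] [Module A N₁] [AddCommGroup N₂] [Module A N₂]
    [AddCommGroup L₁] [Module A L₁] [AddCommGroup L₂] [Module A L₂] [AddCommGroup L] [Module A L]
    (h₁ : IsSummand A N₁ L₁) (h₂ : IsSummand A N₂ L₂) (e : (L₁ × L₂) ≃ₗ[A] L) :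
    IsSummand A (N₁ × N₂) L := by
  obtain ⟨i₁, p₁, h₁⟩ := h₁
  obtain ⟨i₂, p₂, h₂⟩ := h₂
  refine ⟨e.toLinearMap ∘ₗ i₁.prodMap i₂, p₁.prodMap p₂ ∘ₗ e.symm.toLinearMap, ?_⟩
  have h₁' : ∀ x, p₁ (i₁ x) = x := fun x => LinearMap.congr_fun h₁ x
  have h₂' : ∀ x, p₂ (i₂ x) = x := fun x => LinearMap.congr_fun h₂ x
  refine LinearMap.ext fun x => ?_
  simp [h₁', h₂']

theorem MemFinAdd.prod {A : Type v} [Ring A] {M N₁ N₂ : Type u} [AddCommGroup M] [Module A M]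
    [AddCommGroup N₁] [Module A N₁] [AddCommGroup N₂] [Module A N₂]
    (h₁ : MemFinAdd A M N₁) (h₂ : MemFinAdd A M N₂) : MemFinAdd A M (N₁ × N₂) := by
  obtain ⟨m, h₁⟩ := h₁
  obtain ⟨n, h₂⟩ := h₂
  exact ⟨m + n, h₁.prod h₂ ((LinearEquiv.sumArrowLequivProdArrow (Fin m) (Fin n) A M).symm.trans
    (LinearEquiv.funCongrLeft A M finSumFinEquiv.symm))⟩

theorem MemAdd.prod {A : Type v} [Ring A] {M N₁ N₂ : Type u} [AddCommGroup M] [Module A M]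
    [AddCommGroup N₁] [Module A N₁] [AddCommGroup N₂] [Module A N₂]
    (h₁ : MemAdd A M N₁) (h₂ : MemAdd A M N₂) : MemAdd A M (N₁ × N₂) := by
  obtain ⟨α, h₁⟩ := h₁
  obtain ⟨β, h₂⟩ := h₂
  exact ⟨α ⊕ β, h₁.prod h₂ (Finsupp.sumFinsuppLEquivProdFinsupp A).symm⟩

theorem IsCountablyGen.prod {A : Type v} [Ring A] {N₁ N₂ : Type u}
    [AddCommGroup N₁] [Module A N₁] [AddCommGroup N₂] [Module A N₂]
    (h₁ : IsCountablyGen A N₁) (h₂ : IsCountablyGen A N₂) : IsCountablyGen A (N₁ × N₂) := by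
  obtain ⟨s, hs, h₁⟩ := h₁
  obtain ⟨t, ht, h₂⟩ := h₂
  refine ⟨LinearMap.inl A N₁ N₂ '' s ∪ LinearMap.inr A N₁ N₂ '' t,
    (hs.image _).union (ht.image _), ?_⟩
  rw [LinearMap.span_inl_union_inr, h₁, h₂, Submodule.prod_top]

/-- The relation of being isomorphic, on the `A`-modules of the universe `u`. -/
instance isoSetoid (A : Type v) [Ring A] : Setoid (ModuleCat.{u} A) where
  r X Y := Nonempty (X ≃ₗ[A] Y)
  iseqv := ⟨fun _ => ⟨LinearEquiv.refl _ _⟩, fun ⟨e⟩ => ⟨e.symm⟩, fun ⟨e⟩ ⟨f⟩ => ⟨e.trans f⟩⟩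

/-- Isomorphism classes of `A`-modules. -/
def IsoClass (A : Type v) [Ring A] : Type (max v (u + 1)) :=
  Quotient (isoSetoid.{u, v} A)

/-- The isomorphism class `[N]` of the module `N`. -/
def isoClass (A : Type v) [Ring A] (N : Type u) [AddCommGroup N] [Module A N] :
    IsoClass.{u, v} A :=
  Quotient.mk (isoSetoid A) (ModuleCat.of A N)

theorem isoClass_eq_iff {A : Type v} [Ring A] {N L : Type u} [AddCommGroup N] [Module A N]
    [AddCommGroup L] [Module A L] : isoClass A N = isoClass A L ↔ Nonempty (N ≃ₗ[A] L) :=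
  Quotient.eq (r := isoSetoid A)

instance (A : Type v) [Ring A] : Zero (IsoClass.{u, v} A) := ⟨isoClass A PUnit⟩

instance (A : Type v) [Ring A] : Add (IsoClass.{u, v} A) where
  add := Quotient.map₂ (fun X Y => ModuleCat.of A (X × Y))
    fun _ _ ⟨e⟩ _ _ ⟨f⟩ => ⟨LinearEquiv.prodCongr e f⟩

/-- The isomorphism classes of modules form a commutative monoid, with `[N] + [L] = [N ⊕ L]`. -/
instance (A : Type v) [Ring A] : AddCommMonoid (IsoClass.{u, v} A) where
  add_assoc := by
    rintro ⟨X⟩ ⟨Y⟩ ⟨Z⟩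
    exact Quotient.sound ⟨LinearEquiv.prodAssoc A X Y Z⟩
  zero_add := by
    rintro ⟨X⟩
    exact Quotient.sound ⟨LinearEquiv.uniqueProd⟩
  add_zero := by
    rintro ⟨X⟩
    exact Quotient.sound ⟨LinearEquiv.prodUnique⟩
  add_comm := by
    rintro ⟨X⟩ ⟨Y⟩
    exact Quotient.sound ⟨LinearEquiv.prodComm A X Y⟩
  nsmul := nsmulRec

theorem isoClass_add (A : Type v) [Ring A] (N L : Type u) [AddCommGroup N] [Module A N]
    [AddCommGroup L] [Module A L] : isoClass A N + isoClass A L = isoClass A (N × L) := rfl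

/-- The monoid `V(M)` of isomorphism classes of modules in `add(M)`. -/
def VMonoid (A : Type v) [Ring A] (M : Type u) [AddCommGroup M] [Module A M] :
    AddSubmonoid (IsoClass.{u, v} A) where
  carrier := {x | ∃ N : ModuleCat.{u} A, isoClass A N = x ∧ MemFinAdd A M N}
  zero_mem' := ⟨ModuleCat.of A PUnit, rfl, 0, 0, 0, LinearMap.ext fun _ => rfl⟩
  add_mem' := by
    rintro _ _ ⟨N, rfl, hN⟩ ⟨L, rfl, hL⟩
    exact ⟨ModuleCat.of A (N × L), rfl, hN.prod hL⟩

/-- The monoid `V*(M)` of isomorphism classes of countably generated modules in `Add(M)`. -/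
def VStar (A : Type v) [Ring A] (M : Type u) [AddCommGroup M] [Module A M] :
    AddSubmonoid (IsoClass.{u, v} A) where
  carrier := {x | ∃ N : ModuleCat.{u} A, isoClass A N = x ∧ IsCountablyGen A N ∧ MemAdd A M N}
  zero_mem' := ⟨ModuleCat.of A PUnit, rfl, ⟨∅, Set.countable_empty, Subsingleton.elim _ _⟩,
    PEmpty, 0, 0, LinearMap.ext fun _ => rfl⟩
  add_mem' := by
    rintro _ _ ⟨N, rfl, hN, hN'⟩ ⟨L, rfl, hL, hL'⟩
    exact ⟨ModuleCat.of A (N × L), rfl, hN.prod hL, hN'.prod hL'⟩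

/-! ### Trace ideals and relatively big projective modules -/

section

variable (A : Type u) [Ring A]

/-- The trace of a module `P`: the sum of the images of all homomorphisms `P → A`. -/
def traceOf (P : Type u) [AddCommGroup P] [Module A P] : Ideal A :=
  ⨆ f : P →ₗ[A] A, LinearMap.range f

instance (P : Type u) [AddCommGroup P] [Module A P] : (traceOf A P).IsTwoSided where
  mul_mem_of_left {a} b ha := by
    have h : traceOf A P ≤ Submodule.comap (LinearMap.toSpanSingleton A A b) (traceOf A P) := by
      refine iSup_le fun f => ?_
      rintro _ ⟨x, rfl⟩
      exact Submodule.mem_iSup_of_mem (LinearMap.toSpanSingleton A A b ∘ₗ f) ⟨x, rfl⟩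
    exact h ha

/-- The set `𝒯` of trace ideals of countably generated projective modules. -/
def TraceIdeals : Type u :=
  {I : Ideal A // ∃ P : ModuleCat.{u} A,
    IsCountablyGen A P ∧ Module.Projective A P ∧ traceOf A P = I}

variable {A}

/-- A trace ideal, as an ideal. -/
def TraceIdeals.ideal (I : TraceIdeals A) : Ideal A := I.1

instance (I : TraceIdeals A) : I.ideal.IsTwoSided := by
  obtain ⟨_, P, _, _, rfl⟩ := I
  exact inferInstanceAs (traceOf A P).IsTwoSided

/-- `P` is big with respect to `I` (`I`-big): every countably generated projective module `Q` with
`I Q = Q` is a homomorphic image of `P`. -/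
def IsBig (I : Ideal A) (P : Type u) [AddCommGroup P] [Module A P] : Prop :=
  ∀ Q : ModuleCat.{u} A, IsCountablyGen A Q → Module.Projective A Q →
    I • (⊤ : Submodule A Q) = ⊤ → ∃ f : P →ₗ[A] Q, Function.Surjective f

/-- The graph of the embedding `ι_I : V(A/I) → V*(A)`: `IotaRel I q p` says that `p = [P]` for a
countably generated projective `I`-big module `P` such that `q = [P/IP]`. -/
def IotaRel (I : TraceIdeals A) (q : IsoClass.{u, u} (A ⧸ I.ideal)) (p : IsoClass.{u, u} A) : Prop :=
  ∃ P : ModuleCat.{u} A, isoClass A P = p ∧ IsCountablyGen A P ∧ Module.Projective A P ∧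
    IsBig I.ideal P ∧
    isoClass (A ⧸ I.ideal) (P ⧸ I.ideal • (⊤ : Submodule A P)) = q

end

/-! ### Passing from `M` to its endomorphism ring -/

section

variable (R : Type v) [Ring R] (M : Type u) [AddCommGroup M] [Module R M]

/-- The opposite ring of `S = End_R(M)`, whose (left) modules are the right `S`-modules. For every
`R`-module `X`, the right `S`-module structure of `Hom_R(M, X)` is precomposition. -/
abbrev EndOp : Type u := (Module.End R M)ᵈᵐᵃ

/-- The map `[X] ↦ [Hom_R(M, X)]` from isomorphism classes of `R`-modules to isomorphism classes of
right modules over `S = End_R(M)`. -/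
def homClass : IsoClass.{u, v} R → IsoClass.{u, u} (EndOp R M) :=
  Quotient.map (fun X => ModuleCat.of (EndOp R M) (M →ₗ[R] X)) fun _ _ ⟨e⟩ =>
    ⟨{ toFun := fun f => e.toLinearMap ∘ₗ f
       invFun := fun f => e.symm.toLinearMap ∘ₗ f
       map_add' := fun f g => LinearMap.comp_add f g e.toLinearMap
       map_smul' := fun _ _ => rfl
       left_inv := fun f => LinearMap.ext fun x => e.symm_apply_apply (f x)
       right_inv := fun f => LinearMap.ext fun x => e.apply_symm_apply (f x) }⟩

variable {R M}

/-- The graph of `α_I : V(S/I) → V*(M)`, the composition of `ι_I : V(S/I) → V*(S)` with the isomorphism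
`V*(S) ≅ V*(M)` inverse to `[X] ↦ [Hom_R(M, X)]`. -/
def AlphaRel (I : TraceIdeals (EndOp R M)) (q : IsoClass.{u, u} (EndOp R M ⧸ I.ideal))
    (x : IsoClass.{u, v} R) : Prop :=
  x ∈ VStar R M ∧ IotaRel I q (homClass R M x)

variable (R M)

/-- `V(S/I)` for `S = End_R(M)`: isomorphism classes of finitely generated projective right
`S/I`-modules. -/
abbrev VQuot (I : TraceIdeals (EndOp R M)) : AddSubmonoid (IsoClass.{u, u} (EndOp R M ⧸ I.ideal)) :=
  VMonoid (EndOp R M ⧸ I.ideal) (EndOp R M ⧸ I.ideal)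

/-- `B(M)`: the union of the sets `α_I(V(S/I))` over the nonzero trace ideals `I` of `S`. -/
def BSet : Set (IsoClass.{u, v} R) :=
  {x | ∃ I : TraceIdeals (EndOp R M), I.ideal ≠ ⊥ ∧ ∃ q ∈ VQuot R M I, AlphaRel I q x}

end

/-! Put `A = EndOp R M`. It is a module-finite algebra over the commutative noetherian ring `R`,
hence noetherian. As `M` is finitely generated, `Hom(M, -)` identifies the countably generated
modules in `Add(M)` with the countably generated projective `A`-modules, and `add(M)` with the
finitely generated ones. It remains to show that each countably generated projective `P` is `I`-big
with `P/IP` finitely generated for exactly one trace ideal `I`, that `(I, P/IP)` determines `P`, and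
that every pair occurs. The case `I = 0` is that of finitely generated `P`.

Finding `I`: a dual basis yields finitely generated submodules `X k` exhausting `P` whose traces `I
k = tr(P/X k)` satisfy `I (k+1) ≤ I k * I (k+1)`. Such chains are stationary
(`exists_forall_le_sup`). Noetherian induction reduces this to a prime factor ring, finite over its
centre, with a nonzero central `s` that multiplies each two-sided ideal into the ideal generated by
its central elements (`exists_central_smul_mem`). By Cayley–Hamilton every member of a chain without
zero terms contains a power of `s`, and modulo `s` the chain is stationary by induction. The limit
`I` is idempotent, lies in all `tr(P/X)`, and `P/IP` is finitely generated. A surjection from `P`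
onto any countably generated `Q = IQ` is built step by step
(`exists_surjective_of_le_traceOf_quotient`), so `P` is `I`-big.

Uniqueness: an `I`-big module absorbs countably generated projectives `Q = IQ`, which gives
`IsBig.nonempty_equiv`; `IsBig.traceOf_le` forces the ideal to be unique.

Existence: a finitely generated projective `A/I`-module lifts to the direct limit of a free module
along one endomorphism `φ` with `ψφ² = φ` (`exists_projective_lift`). The same construction, applied
to the zero module, shows that idempotent ideals are traces. -/

/-! ### Countably generated modules. -/

section CountablyGenerated

variable {A : Type v} [Ring A] {P Q : Type u} [AddCommGroup P] [Module A P]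
  [AddCommGroup Q] [Module A Q]

theorem IsCountablyGen.of_surjective (h : IsCountablyGen A P) (f : P →ₗ[A] Q)
    (hf : Function.Surjective f) : IsCountablyGen A Q := by
  obtain ⟨s, hs, h⟩ := h
  refine ⟨f '' s, hs.image _, ?_⟩
  rw [← Submodule.map_span, h, Submodule.map_top, LinearMap.range_eq_top.2 hf]

theorem IsCountablyGen.of_finite [h : Module.Finite A P] : IsCountablyGen A P := by
  obtain ⟨s, hs⟩ := h.fg_top
  exact ⟨s, s.countable_toSet, hs⟩

theorem IsCountablyGen.exists_seq (h : IsCountablyGen A P) :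
    ∃ x : ℕ → P, Submodule.span A (Set.range x) = ⊤ := by
  obtain ⟨s, hs, h⟩ := h
  obtain ⟨x, hx⟩ := (hs.insert 0).exists_eq_range ⟨0, Set.mem_insert _ _⟩
  exact ⟨x, by rw [← hx, Submodule.span_insert_zero, h]⟩

theorem isCountablyGen_iff_exists_iSup_fg :
    IsCountablyGen A P ↔ ∃ X : ℕ → Submodule A P, (∀ n, (X n).FG) ∧ ⨆ n, X n = ⊤ := by
  constructor
  · intro h
    obtain ⟨x, hx⟩ := h.exists_seq
    refine ⟨fun n => Submodule.span A {x n}, fun n => Submodule.fg_span_singleton _, ?_⟩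
    rw [← Submodule.span_iUnion, ← hx, Set.iUnion_singleton_eq_range]
  · rintro ⟨X, hX, h⟩
    choose s hs using hX
    refine ⟨⋃ n, (s n : Set P), Set.countable_iUnion fun n => (s n).countable_toSet, ?_⟩
    rw [Submodule.span_iUnion, ← h]
    simp only [hs]

theorem IsCountablyGen.finsupp (h : IsCountablyGen A P) (ι : Type*) [Countable ι] :
    IsCountablyGen A (ι →₀ P) := by
  obtain ⟨s, hs, h⟩ := h
  refine ⟨⋃ n, Finsupp.lsingle (R := A) n '' s, Set.countable_iUnion fun n => hs.image _, ?_⟩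
  simp only [Submodule.span_iUnion, ← Submodule.map_span, h, Submodule.map_top]
  exact Finsupp.iSup_lsingle_range

/-- A countably generated module is the union of an increasing sequence of finitely generated
submodules. -/
theorem IsCountablyGen.exists_monotone_fg (h : IsCountablyGen A P) :
    ∃ X : ℕ → Submodule A P, Monotone X ∧ (∀ n, (X n).FG) ∧ ∀ p, ∃ n, p ∈ X n := by
  obtain ⟨X, hX, h⟩ := isCountablyGen_iff_exists_iSup_fg.1 h
  have hm : Monotone fun n => ⨆ i ∈ Finset.range n, X i := fun a b hab =>
    biSup_mono fun i hi => Finset.range_mono hab hi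
  refine ⟨_, hm, fun n => Submodule.fg_biSup _ _ fun i _ => hX i, fun p => ?_⟩
  have hp : p ∈ ⨆ n, ⨆ i ∈ Finset.range n, X i := by
    have : (⨆ n, ⨆ i ∈ Finset.range n, X i) = ⊤ := by
      rw [eq_top_iff, ← h]
      exact iSup_le fun i => le_iSup_of_le (i + 1)
        (le_biSup X (Finset.mem_range.2 (Nat.lt_succ_self i)))
    rw [this]; trivial
  exact (Submodule.mem_iSup_of_directed _ hm.directed_le).1 hp

theorem IsCountablyGen.submodule [IsNoetherianRing A] (h : IsCountablyGen A P)
    (N : Submodule A P) : IsCountablyGen A N := by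
  obtain ⟨X, hm, hX, h⟩ := h.exists_monotone_fg
  refine isCountablyGen_iff_exists_iSup_fg.2 ⟨fun n => (X n).comap N.subtype, fun n => ?_, ?_⟩
  · have : IsNoetherian A (X n) := isNoetherian_of_fg_of_noetherian _ (hX n)
    refine Submodule.fg_of_fg_map_injective N.subtype N.injective_subtype ?_
    rw [Submodule.map_comap_subtype]
    have : IsNoetherian A ↥(N ⊓ X n) :=
      isNoetherian_of_injective (Submodule.inclusion inf_le_right)
        (Submodule.inclusion_injective inf_le_right)
    exact Submodule.FG.of_finite
  · refine eq_top_iff.2 fun x _ => ?_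
    obtain ⟨n, hn⟩ := h x
    exact Submodule.mem_iSup_of_mem n hn

end CountablyGenerated

/-! ### Trace ideals of modules and of their quotients. -/

section Trace

variable {A : Type u} [Ring A] {P Q : Type u} [AddCommGroup P] [Module A P]
  [AddCommGroup Q] [Module A Q]

theorem apply_mem_traceOf (f : P →ₗ[A] A) (x : P) : f x ∈ traceOf A P :=
  Submodule.mem_iSup_of_mem f ⟨x, rfl⟩

theorem traceOf_le_of_surjective (g : P →ₗ[A] Q) (hg : Function.Surjective g) :
    traceOf A Q ≤ traceOf A P := by
  refine iSup_le fun f => ?_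
  rintro _ ⟨y, rfl⟩
  obtain ⟨x, rfl⟩ := hg y
  exact apply_mem_traceOf (f ∘ₗ g) x

theorem traceOf_le_of_smul_top (I : Ideal A) [I.IsTwoSided]
    (h : I • (⊤ : Submodule A P) = ⊤) : traceOf A P ≤ I := by
  refine iSup_le fun f => ?_
  rintro _ ⟨x, rfl⟩
  have hx : x ∈ I • (⊤ : Submodule A P) := by rw [h]; trivial
  refine Submodule.smul_induction_on hx (fun a ha y _ => ?_) fun x y hx hy => ?_
  · rw [map_smul]
    exact I.mul_mem_right _ ha
  · rw [map_add]
    exact I.add_mem hx hy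

/-- A section `s` of the canonical map from the free module on `P` is a dual basis: `x = ∑ s(x)_p
p`, and the coordinates `s(x)_p` lie in the trace. -/
theorem traceOf_smul_top [Module.Projective A P] :
    traceOf A P • (⊤ : Submodule A P) = ⊤ := by
  refine eq_top_iff.2 fun x _ => ?_
  obtain ⟨s, hs⟩ := Module.projective_def'.1 ‹Module.Projective A P›
  have hx : Finsupp.linearCombination A id (s x) = x := LinearMap.congr_fun hs x
  rw [← hx, Finsupp.linearCombination_apply]
  exact Submodule.sum_mem _ fun p _ => Submodule.smul_mem_smul
    (apply_mem_traceOf (Finsupp.lapply p ∘ₗ s) x) trivial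

theorem traceOf_mul_self [Module.Projective A P] :
    traceOf A P * traceOf A P = traceOf A P := by
  refine le_antisymm Ideal.mul_le_right (iSup_le fun f => ?_)
  rintro _ ⟨x, rfl⟩
  have hx : x ∈ traceOf A P • (⊤ : Submodule A P) := by rw [traceOf_smul_top]; trivial
  refine Submodule.smul_induction_on hx (fun a ha y _ => ?_) fun x y hx hy => ?_
  · rw [map_smul]
    exact Submodule.smul_mem_smul ha (apply_mem_traceOf f y)
  · rw [map_add]
    exact Submodule.add_mem _ hx hy

/-- Together with `traceOf_quotient_le`, this replaces functionals on `P ⧸ X` by functionals on `P`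
that vanish on `X`. -/
theorem apply_mem_traceOf_quotient {X : Submodule A P} (f : P →ₗ[A] A) (hf : X ≤ LinearMap.ker f)
    (x : P) : f x ∈ traceOf A (P ⧸ X) :=
  apply_mem_traceOf (X.liftQ f hf) (Submodule.Quotient.mk x)

theorem traceOf_quotient_le {X : Submodule A P} {J : Submodule A A}
    (h : ∀ f : P →ₗ[A] A, X ≤ LinearMap.ker f → ∀ x, f x ∈ J) : traceOf A (P ⧸ X) ≤ J := by
  refine iSup_le fun f => ?_
  rintro _ ⟨x, rfl⟩
  obtain ⟨x, rfl⟩ := X.mkQ_surjective x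
  refine h (f ∘ₗ X.mkQ) (fun y hy => ?_) x
  have : X.mkQ y = 0 := (Submodule.Quotient.mk_eq_zero X).2 hy
  rw [LinearMap.mem_ker, LinearMap.comp_apply, this, map_zero]

theorem traceOf_quotient_antitone {X Y : Submodule A P} (h : X ≤ Y) :
    traceOf A (P ⧸ Y) ≤ traceOf A (P ⧸ X) :=
  traceOf_quotient_le fun f hf x => apply_mem_traceOf_quotient f (h.trans hf) x

theorem finsupp_smul_top {ι : Type*} (I : Ideal A) (h : I • (⊤ : Submodule A P) = ⊤) :
    I • (⊤ : Submodule A (ι →₀ P)) = ⊤ := by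
  have hle : ⨆ i, LinearMap.range (Finsupp.lsingle (R := A) (M := P) i) ≤
      I • (⊤ : Submodule A (ι →₀ P)) := iSup_le fun i => by
    rw [LinearMap.range_eq_map, ← h, Submodule.map_smul'']
    exact Submodule.smul_mono le_rfl le_top
  rwa [Finsupp.iSup_lsingle_range, top_le_iff] at hle

end Trace

/-! ### Building surjections from lower bounds on traces. -/

section Big

variable {A : Type u} [Ring A] {P Q : Type u} [AddCommGroup P] [Module A P]
  [AddCommGroup Q] [Module A Q]

/-- A linear map `f : P → Q` with finitely generated image attained on the finitely generated
submodule `X`: a finite stage in the construction of a surjection `P → Q`. -/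
structure IsFiniteStage (f : P →ₗ[A] Q) (X : Submodule A P) : Prop where
  fg : X.FG
  fg_range : (LinearMap.range f).FG
  range_le : LinearMap.range f ≤ X.map f

/-- The stage `(g, Y)` extends the stage `(f, X)`. -/
structure StageExtends (f : P →ₗ[A] Q) (X : Submodule A P) (g : P →ₗ[A] Q) (Y : Submodule A P) :
    Prop where
  stage : IsFiniteStage g Y
  le : X ≤ Y
  eqOn : ∀ x ∈ X, g x = f x

theorem IsFiniteStage.refl {f : P →ₗ[A] Q} {X : Submodule A P} (h : IsFiniteStage f X) :
    StageExtends f X f X := ⟨h, le_rfl, fun _ _ => rfl⟩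

theorem StageExtends.trans {f g k : P →ₗ[A] Q} {X Y Z : Submodule A P} (h : StageExtends f X g Y)
    (h' : StageExtends g Y k Z) : StageExtends f X k Z :=
  ⟨h'.stage, h.le.trans h'.le, fun x hx => (h'.eqOn x (h.le hx)).trans (h.eqOn x hx)⟩

theorem StageExtends.range_le {f g : P →ₗ[A] Q} {X Y : Submodule A P} (hf : IsFiniteStage f X)
    (h : StageExtends f X g Y) : LinearMap.range f ≤ LinearMap.range g := by
  refine hf.range_le.trans ?_
  rintro _ ⟨x, hx, rfl⟩
  exact ⟨x, h.eqOn x hx⟩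

theorem IsFiniteStage.sup {f : P →ₗ[A] Q} {X Y : Submodule A P} (h : IsFiniteStage f X)
    (hY : Y.FG) : StageExtends f X f (X ⊔ Y) :=
  ⟨⟨h.fg.sup hY, h.fg_range, h.range_le.trans (Submodule.map_mono le_sup_left)⟩, le_sup_left,
    fun _ _ => rfl⟩

/-- Adding the map `x ↦ g x • q` to `f` changes nothing on `X`, where `g` vanishes. The old range is
attained on `X` and so survives; hence the differences `g x • q` of new and old values lie in the
new range. That range is finitely generated because `A` is noetherian, so enlarging `X` by finitely
many preimages gives a stage again. -/
theorem IsFiniteStage.exists_stageExtends [IsNoetherianRing A] {f : P →ₗ[A] Q} {X : Submodule A P}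
    (h : IsFiniteStage f X) (g : P →ₗ[A] A) (hg : X ≤ LinearMap.ker g) (q : Q) :
    ∃ f' Y, StageExtends f X f' Y ∧ ∀ x, g x • q ∈ LinearMap.range f' := by
  set f' : P →ₗ[A] Q := f + LinearMap.toSpanSingleton A Q q ∘ₗ g with hf'
  have hX : ∀ x ∈ X, f' x = f x := fun x hx => by
    have : g x = 0 := hg hx
    simp [hf', this]
  have hfg : (LinearMap.range f').FG := by
    have hle : LinearMap.range f' ≤ LinearMap.range f ⊔ Submodule.span A {q} := by
      rintro _ ⟨x, rfl⟩
      refine Submodule.add_mem_sup ⟨x, rfl⟩ ?_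
      exact Submodule.smul_mem _ _ (Submodule.mem_span_singleton_self q)
    have : IsNoetherian A ↥(LinearMap.range f ⊔ Submodule.span A {q}) :=
      isNoetherian_of_fg_of_noetherian _ (h.fg_range.sup (Submodule.fg_span_singleton q))
    have : IsNoetherian A (LinearMap.range f') :=
      isNoetherian_of_injective (Submodule.inclusion hle) (Submodule.inclusion_injective hle)
    exact Submodule.FG.of_finite
  obtain ⟨Z, hZ, hZ'⟩ : ∃ Z : Submodule A P, Z.FG ∧ Z.map f' = LinearMap.range f' := by
    classical
    obtain ⟨s, hs⟩ := hfg
    have hsub : (s : Set Q) ⊆ f' '' Set.univ := by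
      rw [Set.image_univ, ← LinearMap.coe_range, ← hs]
      exact Submodule.subset_span
    obtain ⟨t, -, ht⟩ := Finset.subset_set_image_iff.1 hsub
    exact ⟨Submodule.span A t, ⟨t, rfl⟩, by rw [Submodule.map_span, ← hs, ← ht, Finset.coe_image]⟩
  refine ⟨f', X ⊔ Z, ⟨⟨h.fg.sup hZ, hfg, hZ'.ge.trans (Submodule.map_mono le_sup_right)⟩,
    le_sup_left, hX⟩, fun x => ?_⟩
  have h1 : f x ∈ LinearMap.range f' := by
    obtain ⟨y, hy, hyx⟩ := h.range_le ⟨x, rfl⟩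
    exact ⟨y, (hX y hy).trans hyx⟩
  have h2 : g x • q = f' x - f x := by simp [hf']
  rw [h2]
  exact Submodule.sub_mem _ ⟨x, rfl⟩ h1

/-- Among all extensions, take one for which the left ideal `{a | a • q ∈ range f'}` is maximal. No
functional vanishing on `Y` can enlarge it, so it contains `tr(P/Y)`, and therefore `I`. -/
theorem IsFiniteStage.exists_smul_mem [IsNoetherianRing A] {I : Ideal A}
    (hI : ∀ X : Submodule A P, X.FG → I ≤ traceOf A (P ⧸ X)) {f : P →ₗ[A] Q} {X : Submodule A P}
    (h : IsFiniteStage f X) (q : Q) :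
    ∃ f' Y, StageExtends f X f' Y ∧ ∀ a ∈ I, a • q ∈ LinearMap.range f' := by
  obtain ⟨N, ⟨f', Y, hY, rfl⟩, hmax⟩ := set_has_maximal_iff_noetherian.2
    (isNoetherian_of_isNoetherianRing_of_finite A A)
    {N : Ideal A | ∃ f' Y, StageExtends f X f' Y ∧
      (LinearMap.range f').comap (LinearMap.toSpanSingleton A Q q) = N} ⟨_, f, X, h.refl, rfl⟩
  refine ⟨f', Y, hY, fun a ha => ?_⟩
  have key : traceOf A (P ⧸ Y) ≤ (LinearMap.range f').comap (LinearMap.toSpanSingleton A Q q) := by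
    refine traceOf_quotient_le fun g hg x => ?_
    obtain ⟨k, Z, hZ, hk⟩ := hY.stage.exists_stageExtends g hg q
    have hle := Submodule.comap_mono (f := LinearMap.toSpanSingleton A Q q)
      (hZ.range_le hY.stage)
    have := hmax _ ⟨k, Z, hY.trans hZ, rfl⟩
    have heq := eq_of_le_of_not_lt hle this
    rw [heq]
    exact hk x
  exact key (hI Y hY.stage.fg ha)

theorem IsFiniteStage.exists_mem_range [IsNoetherianRing A] {I : Ideal A}
    (hI : ∀ X : Submodule A P, X.FG → I ≤ traceOf A (P ⧸ X)) {y : Q}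
    (hy : y ∈ I • (⊤ : Submodule A Q)) {f : P →ₗ[A] Q} {X : Submodule A P}
    (h : IsFiniteStage f X) : ∃ f' Y, StageExtends f X f' Y ∧ y ∈ LinearMap.range f' := by
  refine Submodule.smul_induction_on (p := fun y => ∀ {f : P →ₗ[A] Q} {X : Submodule A P},
    IsFiniteStage f X → ∃ f' Y, StageExtends f X f' Y ∧ y ∈ LinearMap.range f') hy
    (fun a ha q _ f X h => ?_) (fun y z hy hz f X h => ?_) h
  · obtain ⟨f', Y, hY, h'⟩ := h.exists_smul_mem hI q
    exact ⟨f', Y, hY, h' a ha⟩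
  · obtain ⟨f', Y, hY, h'⟩ := hy h
    obtain ⟨k, Z, hZ, hk⟩ := hz hY.stage
    exact ⟨k, Z, hY.trans hZ, Submodule.add_mem _ (hZ.range_le hY.stage h') hk⟩

/-- If every `P ⧸ X` with `X` finitely generated has trace containing `I`, then every countably
generated module `Q` with `I Q = Q` is a homomorphic image of `P`. -/
theorem exists_surjective_of_le_traceOf_quotient [IsNoetherianRing A] (hP : IsCountablyGen A P)
    (hQ : IsCountablyGen A Q) {I : Ideal A}
    (hI : ∀ X : Submodule A P, X.FG → I ≤ traceOf A (P ⧸ X))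
    (hIQ : I • (⊤ : Submodule A Q) = ⊤) : ∃ f : P →ₗ[A] Q, Function.Surjective f := by
  obtain ⟨x, hx⟩ := hP.exists_seq
  obtain ⟨y, hy⟩ := hQ.exists_seq
  -- Step `n` puts the generator `x n` of `P` into the frozen domain and the generator `y n` of `Q`
  -- into the range, so the frozen domains exhaust `P` and the limit map is onto.
  have step : ∀ (n : ℕ) (s : {s : (P →ₗ[A] Q) × Submodule A P // IsFiniteStage s.1 s.2}),
      ∃ t : {s : (P →ₗ[A] Q) × Submodule A P // IsFiniteStage s.1 s.2},
        StageExtends s.1.1 s.1.2 t.1.1 t.1.2 ∧ x n ∈ t.1.2 ∧ y n ∈ LinearMap.range t.1.1 := by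
    rintro n ⟨⟨f, X⟩, h⟩
    have hyn : y n ∈ I • (⊤ : Submodule A Q) := by rw [hIQ]; trivial
    obtain ⟨f', Y, hY, h'⟩ := h.exists_mem_range hI hyn
    have hZ := hY.stage.sup (Submodule.fg_span_singleton (R := A) (x n))
    exact ⟨⟨(f', _), hZ.stage⟩, hY.trans hZ,
      Submodule.mem_sup_right (Submodule.mem_span_singleton_self _), h'⟩
  choose next hnext using step
  let s : ℕ → {s : (P →ₗ[A] Q) × Submodule A P // IsFiniteStage s.1 s.2} := fun n =>
    Nat.rec ⟨(0, ⊥), Submodule.fg_bot, by rw [LinearMap.range_zero]; exact Submodule.fg_bot,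
      by rw [LinearMap.range_zero]; exact bot_le⟩ next n
  have hs : ∀ n, s (n + 1) = next n (s n) := fun n => rfl
  have hext : ∀ m n, m ≤ n → StageExtends (s m).1.1 (s m).1.2 (s n).1.1 (s n).1.2 := by
    intro m n hmn
    induction n, hmn using Nat.le_induction with
    | base => exact (s m).2.refl
    | succ n _ ih => exact ih.trans (hs n ▸ (hnext n (s n)).1)
  have hmem : ∀ p, ∃ n, p ∈ (s n).1.2 := by
    have hdir : Directed (· ≤ ·) fun n => (s n).1.2 :=
      Monotone.directed_le fun m n hmn => (hext m n hmn).le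
    intro p
    refine (Submodule.mem_iSup_of_directed _ hdir).1 ?_
    have : (⨆ n, (s n).1.2) = ⊤ := by
      rw [eq_top_iff, ← hx, Submodule.span_le]
      rintro _ ⟨n, rfl⟩
      exact Submodule.mem_iSup_of_mem (n + 1) (hs n ▸ (hnext n (s n)).2.1)
    rw [this]; trivial
  choose N hN using hmem
  -- The value at `p` is the same at every stage whose frozen domain contains `p`, which makes the
  -- limit map well defined and linear.
  have hval : ∀ p n, p ∈ (s n).1.2 → (s (N p)).1.1 p = (s n).1.1 p := by
    intro p n hp
    rcases le_total (N p) n with h | h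
    · exact ((hext _ _ h).eqOn p (hN p)).symm
    · exact (hext _ _ h).eqOn p hp
  let f : P →ₗ[A] Q :=
    { toFun := fun p => (s (N p)).1.1 p
      map_add' := fun p q => by
        have hp := (hext _ _ (le_max_left (N p) (N q))).le (hN p)
        have hq := (hext _ _ (le_max_right (N p) (N q))).le (hN q)
        rw [hval p _ hp, hval q _ hq, hval _ _ (Submodule.add_mem _ hp hq), map_add]
      map_smul' := fun a p => by
        rw [hval _ _ (Submodule.smul_mem _ a (hN p)), map_smul, RingHom.id_apply] }
  refine ⟨f, LinearMap.range_eq_top.1 (eq_top_iff.2 ?_)⟩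
  rw [← hy, Submodule.span_le]
  rintro _ ⟨n, rfl⟩
  have h1 : y n ∈ LinearMap.range (s (n + 1)).1.1 := hs n ▸ (hnext n (s n)).2.2
  obtain ⟨p, hp, hpy⟩ := (s (n + 1)).2.range_le h1
  exact ⟨p, (hval p (n + 1) hp).trans hpy⟩

theorem isBig_of_le_traceOf_quotient [IsNoetherianRing A] (hP : IsCountablyGen A P) {I : Ideal A}
    (hI : ∀ X : Submodule A P, X.FG → I ≤ traceOf A (P ⧸ X)) : IsBig I P :=
  fun _ hQ _ hIQ => exists_surjective_of_le_traceOf_quotient hP hQ hI hIQ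

end Big

/-! ### Absorption and uniqueness of relatively big projectives. -/

section Uniqueness

variable {A : Type u} [Ring A] {P Q W : Type u} [AddCommGroup P] [Module A P]
  [AddCommGroup Q] [Module A Q] [AddCommGroup W] [Module A W]

instance Module.Projective.finsupp (A : Type*) [Semiring A] (ι W : Type*) [AddCommMonoid W]
    [Module A W] [Module.Projective A W] : Module.Projective A (ι →₀ W) := by
  classical
  exact Module.Projective.of_equiv (finsuppLequivDFinsupp A).symm

/-- A finitely generated submodule of a direct sum misses some component. -/
theorem exists_apply_eq_zero_of_fg {X : Submodule A (ℕ →₀ W)} (hX : X.FG) :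
    ∃ n, ∀ x ∈ X, x n = 0 := by
  classical
  obtain ⟨s, rfl⟩ := hX
  obtain ⟨n, hn⟩ := Infinite.exists_notMem_finset (s.biUnion fun x => x.support)
  refine ⟨n, fun x hx => ?_⟩
  have hle : Submodule.span A (s : Set (ℕ →₀ W)) ≤ LinearMap.ker (Finsupp.lapply (R := A) n) := by
    refine Submodule.span_le.2 fun y hy => ?_
    by_contra h
    exact hn (Finset.mem_biUnion.2 ⟨y, hy, Finsupp.mem_support_iff.2 h⟩)
  exact hle hx

/-- Given a surjection onto an infinite direct sum of copies of `W`, every finitely generated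
submodule of the source is killed by a surjection onto `W`. -/
theorem exists_surjective_of_finsupp {f : P →ₗ[A] (ℕ →₀ W)} (hf : Function.Surjective f)
    {X : Submodule A P} (hX : X.FG) :
    ∃ g : P →ₗ[A] W, Function.Surjective g ∧ X ≤ LinearMap.ker g := by
  obtain ⟨n, hn⟩ := exists_apply_eq_zero_of_fg (hX.map f)
  refine ⟨Finsupp.lapply n ∘ₗ f, fun w => ?_, fun x hx => hn _ ⟨x, hx, rfl⟩⟩
  obtain ⟨p, hp⟩ := hf (Finsupp.single n w)
  exact ⟨p, by simp [hp]⟩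

theorem traceOf_le_traceOf_quotient {f : P →ₗ[A] (ℕ →₀ W)} (hf : Function.Surjective f)
    {X : Submodule A P} (hX : X.FG) : traceOf A W ≤ traceOf A (P ⧸ X) := by
  obtain ⟨g, hg, hX⟩ := exists_surjective_of_finsupp hf hX
  refine traceOf_le_of_surjective (X.liftQ g hX) fun w => ?_
  obtain ⟨p, rfl⟩ := hg w
  exact ⟨Submodule.Quotient.mk p, rfl⟩

theorem IsBig.exists_surjective_finsupp {I : Ideal A} (hP : IsBig I P) (hW : IsCountablyGen A W)
    [Module.Projective A W] (hI : I • (⊤ : Submodule A W) = ⊤) :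
    ∃ f : P →ₗ[A] (ℕ →₀ W), Function.Surjective f :=
  hP (ModuleCat.of A (ℕ →₀ W)) (hW.finsupp ℕ) (Module.Projective.finsupp A ℕ W)
    (finsupp_smul_top I hI)

/-- A surjection of `P` onto infinitely many copies of `W` has a component `g : P → W` that is onto
and kills `X`. Then `W = g(P) = g(JP) = JW`, whence `tr W ≤ J`. This is the source of the uniqueness
of the trace ideal. -/
theorem IsBig.traceOf_le [Module.Projective A W] (hW : IsCountablyGen A W)
    (hP : IsBig (traceOf A W) P) {J : Ideal A} [J.IsTwoSided]
    (hfin : ∃ X : Submodule A P, X.FG ∧ X ⊔ J • ⊤ = ⊤) : traceOf A W ≤ J := by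
  obtain ⟨X, hX, hXJ⟩ := hfin
  obtain ⟨f, hf⟩ := hP.exists_surjective_finsupp hW traceOf_smul_top
  obtain ⟨g, hg, hgX⟩ := exists_surjective_of_finsupp hf hX
  refine traceOf_le_of_smul_top J ?_
  have := congrArg (Submodule.map g) hXJ
  rwa [Submodule.map_sup, LinearMap.le_ker_iff_map.1 hgX, bot_sup_eq, Submodule.map_smul'',
    Submodule.map_top, LinearMap.range_eq_top.2 hg] at this

/-- The kernel splits off along a surjection onto a projective module. -/
theorem exists_equiv_prod_of_surjective [Module.Projective A Q] (f : P →ₗ[A] Q)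
    (hf : Function.Surjective f) :
    ∃ p : P →ₗ[A] LinearMap.ker f, p ∘ₗ (LinearMap.ker f).subtype = LinearMap.id ∧
      Nonempty ((LinearMap.ker f × Q) ≃ₗ[A] P) := by
  obtain ⟨s, hs⟩ := Module.projective_lifting_property f LinearMap.id hf
  have hs' : ∀ q, f (s q) = q := fun q => LinearMap.congr_fun hs q
  refine ⟨LinearMap.codRestrict _ (LinearMap.id - s ∘ₗ f) fun x => by simp [hs'], ?_,
    ⟨lequivProdOfRightSplitExact (LinearMap.ker f).injective_subtype (Submodule.range_subtype _) hs⟩⟩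
  refine LinearMap.ext fun x => Subtype.ext ?_
  have : f x = 0 := x.2
  simp [this]

/-- A big module absorbs the projective modules to which its bigness refers. -/
theorem IsBig.nonempty_equiv_prod {I : Ideal A} (hP : IsBig I P) (hQ : IsCountablyGen A Q)
    [Module.Projective A Q] (hI : I • (⊤ : Submodule A Q) = ⊤) : Nonempty (P ≃ₗ[A] P × Q) := by
  obtain ⟨f, hf⟩ := hP.exists_surjective_finsupp hQ hI
  obtain ⟨-, -, ⟨e⟩⟩ := exists_equiv_prod_of_surjective f hf
  -- Eilenberg swindle: the summand of countably many copies of `Q` in `P` takes in one more.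
  let e' : (ℕ →₀ Q) ≃ₗ[A] (ℕ →₀ Q) × Q :=
    (Finsupp.domLCongr Equiv.natSumPUnitEquivNat.{0}.symm).trans
      ((Finsupp.sumFinsuppLEquivProdFinsupp A).trans
        ((LinearEquiv.refl A _).prodCongr (Finsupp.uniqueLinearEquiv A Q PUnit.unit.{1})))
  exact ⟨e.symm.trans (((LinearEquiv.refl A _).prodCongr e').trans
    ((LinearEquiv.prodAssoc A _ _ _).symm.trans (e.prodCongr (LinearEquiv.refl A _))))⟩

theorem mem_smul_top_of_mkQ_eq_zero {I : Ideal A} {x : P}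
    (h : (Submodule.Quotient.mk x : P ⧸ I • (⊤ : Submodule A P)) = 0) :
    x ∈ I • (⊤ : Submodule A P) := (Submodule.Quotient.mk_eq_zero _).1 h

theorem mem_smul_top_prod {I : Ideal A} {x : P × Q} (h₁ : x.1 ∈ I • (⊤ : Submodule A P))
    (h₂ : x.2 ∈ I • (⊤ : Submodule A Q)) : x ∈ I • (⊤ : Submodule A (P × Q)) := by
  have e : x = LinearMap.inl A P Q x.1 + LinearMap.inr A P Q x.2 := by simp
  rw [e]
  refine Submodule.add_mem _ ?_ ?_
  · have := Submodule.mem_map_of_mem (f := LinearMap.inl A P Q) h₁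
    rw [Submodule.map_smul''] at this
    exact Submodule.smul_mono le_rfl le_top this
  · have := Submodule.mem_map_of_mem (f := LinearMap.inr A P Q) h₂
    rw [Submodule.map_smul''] at this
    exact Submodule.smul_mono le_rfl le_top this

/-- Relatively big projective modules are determined by their quotient modulo the trace ideal. -/
theorem IsBig.nonempty_equiv [IsNoetherianRing A] [Module.Projective A W]
    (hW : IsCountablyGen A W) [Module.Projective A P] [Module.Projective A Q]
    (hP : IsCountablyGen A P) (hQ : IsCountablyGen A Q) (hPb : IsBig (traceOf A W) P)
    (hQb : IsBig (traceOf A W) Q)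
    (e : (P ⧸ traceOf A W • (⊤ : Submodule A P)) ≃ₗ[A ⧸ traceOf A W]
      (Q ⧸ traceOf A W • (⊤ : Submodule A Q))) : Nonempty (P ≃ₗ[A] Q) := by
  set I := traceOf A W with hI
  have hII : I * I = I := traceOf_mul_self
  have hWI : I • (⊤ : Submodule A W) = ⊤ := traceOf_smul_top
  have hW' : IsCountablyGen A (ℕ →₀ W) := hW.finsupp ℕ
  have hWI' : I • (⊤ : Submodule A (ℕ →₀ W)) = ⊤ := finsupp_smul_top I hWI
  set N : Submodule A Q := I • ⊤ with hN
  have hNI : I • (⊤ : Submodule A N) = ⊤ := by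
    refine Submodule.map_injective_of_injective N.injective_subtype ?_
    rw [Submodule.map_smul'', Submodule.map_top, Submodule.range_subtype, hN, ← Submodule.mul_smul,
      hII]
  -- `N = IQ` need not be projective, so the definition of bigness does not apply; the criterion
  -- through traces covers arbitrary countably generated targets.
  obtain ⟨w, hw⟩ := exists_surjective_of_le_traceOf_quotient hW' (hQ.submodule N) (I := I)
    (fun X hX => traceOf_le_traceOf_quotient (f := LinearMap.id) Function.surjective_id hX) hNI
  obtain ⟨h, hh⟩ := Module.projective_lifting_property N.mkQ
    ((e.toLinearMap.restrictScalars A) ∘ₗ Submodule.mkQ _) N.mkQ_surjective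
  have hh' : ∀ p, (Submodule.Quotient.mk (h p) : Q ⧸ N) = e (Submodule.Quotient.mk p) :=
    fun p => LinearMap.congr_fun hh p
  -- The lift `h` of `e` is onto only modulo `IQ`; the summand mapped by `w` covers the rest.
  let g : P × (ℕ →₀ W) →ₗ[A] Q := h.coprod (N.subtype ∘ₗ w)
  have hg : Function.Surjective g := by
    intro q
    obtain ⟨p, hp⟩ := e.surjective (Submodule.Quotient.mk q)
    obtain ⟨p, rfl⟩ := Submodule.Quotient.mk_surjective _ p
    have hqN : q - h p ∈ N := by
      rw [← Submodule.Quotient.mk_eq_zero, Submodule.Quotient.mk_sub, hh', hp, sub_self]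
    obtain ⟨z, hz⟩ := hw ⟨_, hqN⟩
    exact ⟨(p, z), by simp [g, hz]⟩
  obtain ⟨π, hπ, ⟨e₁⟩⟩ := exists_equiv_prod_of_surjective g hg
  have hπs : Function.Surjective π := fun x => ⟨x, LinearMap.congr_fun hπ x⟩
  have hK : IsCountablyGen A (LinearMap.ker g) := (hP.prod hW').of_surjective π hπs
  have : Module.Projective A (LinearMap.ker g) := Module.Projective.of_split _ π hπ
  -- Modulo `I` the second summand vanishes and `h` becomes the injective map `e`, so the kernel
  -- lies in `I(P × W^(ℕ))`; the retraction `π` then moves it into `I` times itself.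
  have hKI : I • (⊤ : Submodule A (LinearMap.ker g)) = ⊤ := by
    refine eq_top_iff.2 fun x _ => ?_
    have hx : h x.1.1 + w x.1.2 = 0 := x.2
    have hx1 : x.1.1 ∈ I • (⊤ : Submodule A P) := by
      refine mem_smul_top_of_mkQ_eq_zero (e.injective ?_)
      rw [← hh', map_zero, Submodule.Quotient.mk_eq_zero, eq_neg_of_add_eq_zero_left hx]
      exact N.neg_mem (w x.1.2).2
    have hx2 : x.1.2 ∈ I • (⊤ : Submodule A (ℕ →₀ W)) := by rw [hWI']; trivial
    have hx3 : x.1 ∈ I • (⊤ : Submodule A (P × (ℕ →₀ W))) := mem_smul_top_prod hx1 hx2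
    have := Submodule.mem_map_of_mem (f := π) hx3
    rw [Submodule.map_smul''] at this
    have hxx : π x.1 = x := LinearMap.congr_fun hπ x
    rw [← hxx]
    exact Submodule.smul_mono le_rfl le_top this
  obtain ⟨e₂⟩ := hPb.nonempty_equiv_prod hW' hWI'
  obtain ⟨e₃⟩ := hQb.nonempty_equiv_prod hK hKI
  -- `P ≅ P × W^(ℕ) ≅ ker g × Q ≅ Q`: both modules absorb the projectives that are equal to `I`
  -- times themselves.
  exact ⟨e₂.trans (e₁.symm.trans ((LinearEquiv.prodComm A _ _).trans e₃.symm))⟩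

end Uniqueness

/-! ### Projectivity of direct limits along one endomorphism. -/

section Telescope

variable {A : Type u} [Ring A]

/-- A countable union of submodules, on each of which the identity factors compatibly through a
projective module, is projective. -/
theorem Module.Projective.of_exhaustion {P F : Type*} [AddCommGroup P] [Module A P]
    [AddCommGroup F] [Module A F] [Module.Projective A F] (X : ℕ → Submodule A P)
    (hX : Monotone X) (hX' : ∀ p, ∃ n, p ∈ X n) (r : ℕ → P →ₗ[A] F) (j : ℕ → F →ₗ[A] P)
    (hr : ∀ n, ∀ p ∈ X n, j n (r n p) = p) (hj : ∀ n y, j n y ∈ X (n + 1)) :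
    Module.Projective A P := by
  -- The components of a splitting: `j k ∘ d k` is the difference of the consecutive approximations
  -- `j k ∘ r k` of the identity. On `X n` all components after the `n`-th vanish.
  let d : ℕ → P →ₗ[A] F := fun k =>
    Nat.casesOn k (r 0) fun k => r (k + 1) ∘ₗ (LinearMap.id - j k ∘ₗ r k)
  have hd : ∀ k p, d (k + 1) p = r (k + 1) (p - j k (r k p)) := fun k p => rfl
  have hzero : ∀ n p, p ∈ X n → ∀ k, n < k → d k p = 0 := by
    intro n p hp k hk
    obtain ⟨k, rfl⟩ : ∃ k', k = k' + 1 := ⟨k - 1, by omega⟩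
    rw [hd, hr k p (hX (by omega) hp), sub_self, map_zero]
  have hfin : ∀ p, (Function.support fun k => d k p).Finite := by
    intro p
    obtain ⟨n, hn⟩ := hX' p
    refine (Set.finite_Iic n).subset fun k hk => ?_
    by_contra h
    exact hk (hzero n p hn k (not_le.1 h))
  let s : P →ₗ[A] (ℕ →₀ F) :=
    { toFun := fun p => Finsupp.ofSupportFinite (fun k => d k p) (hfin p)
      map_add' := fun p q => Finsupp.ext fun k => map_add (d k) p q
      map_smul' := fun a p => Finsupp.ext fun k => map_smul (d k) a p }
  refine Module.Projective.of_split s (Finsupp.lsum ℕ j) (LinearMap.ext fun p => ?_)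
  have htel : ∀ n, ∑ k ∈ Finset.range (n + 1), j k (d k p) = j n (r n p) := by
    intro n
    induction n with
    | zero => simp [d]
    | succ n ih =>
      rw [Finset.sum_range_succ, ih, hd, map_sub, map_sub, hr (n + 1) _ (hj n _)]
      abel
  obtain ⟨n, hn⟩ := hX' p
  have hsupp : (s p).support ⊆ Finset.range (n + 1) := by
    intro k hk
    rw [Finset.mem_range]
    by_contra h
    exact Finsupp.mem_support_iff.1 hk (hzero n p hn k (by omega))
  rw [LinearMap.comp_apply, Finsupp.lsum_apply,
    Finsupp.sum_of_support_subset _ hsupp _ fun i _ => map_zero _]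
  exact (htel n).trans (hr n p hn)

variable {F : Type u} [AddCommGroup F] [Module A F]

/-- The direct limit of the sequence `F → F → F → ⋯` with all maps equal to `φ`. -/
abbrev Telescope (φ : Module.End A F) : Type u :=
  Module.DirectLimit (fun _ : ℕ => F) (fun i j _ => φ ^ (j - i))

namespace Telescope

/-- The canonical map of the `k`-th term to the direct limit. -/
noncomputable abbrev of (φ : Module.End A F) (k : ℕ) : F →ₗ[A] Telescope φ :=
  Module.DirectLimit.of A ℕ (fun _ => F) (fun i j _ => φ ^ (j - i)) k

variable {φ : Module.End A F}

theorem of_succ (k : ℕ) (x : F) : of φ (k + 1) (φ x) = of φ k x := by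
  have := Module.DirectLimit.of_f (R := A) (G := fun _ : ℕ => F) (f := fun i j _ => φ ^ (j - i))
    (hij := Nat.le_succ k) (x := x)
  rw [← this]
  simp

theorem exists_of (z : Telescope φ) : ∃ k x, of φ k x = z :=
  Module.DirectLimit.exists_of z

/-- The map out of the direct limit induced by a compatible sequence of maps. -/
noncomputable def lift {Q : Type*} [AddCommGroup Q] [Module A Q] (g : ℕ → F →ₗ[A] Q)
    (hg : ∀ k x, g (k + 1) (φ x) = g k x) : Telescope φ →ₗ[A] Q :=
  Module.DirectLimit.lift A ℕ _ _ g fun i j hij x => by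
    obtain ⟨d, rfl⟩ := Nat.exists_eq_add_of_le hij
    rw [Nat.add_sub_cancel_left]
    induction d generalizing x with
    | zero => rfl
    | succ d ih =>
      rw [pow_succ', Module.End.mul_apply, ← Nat.add_assoc, hg]
      exact ih x (Nat.le_add_right _ _)

theorem lift_of {Q : Type*} [AddCommGroup Q] [Module A Q] (g : ℕ → F →ₗ[A] Q)
    (hg : ∀ k x, g (k + 1) (φ x) = g k x) (k : ℕ) (x : F) : lift g hg (of φ k x) = g k x :=
  Module.DirectLimit.lift_of _ _ _

theorem isCountablyGen (hF : IsCountablyGen A F) : IsCountablyGen A (Telescope φ) := by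
  refine (hF.finsupp ℕ).of_surjective (Finsupp.lsum ℕ (of φ)) fun z => ?_
  obtain ⟨k, x, rfl⟩ := exists_of z
  exact ⟨Finsupp.single k x, by simp⟩

/-- If `φ` can be recovered from `φ²`, then it can be recovered from the direct limit. -/
theorem exists_retraction {ψ : Module.End A F} (h : ψ * φ * φ = φ) (k : ℕ) :
    ∃ r : Telescope φ →ₗ[A] F, ∀ x, r (of φ k x) = φ x := by
  -- Truncated subtraction merges two formulas for the map on the `j`-th term: `φ ^ (1 + k - j)`
  -- before the `k`-th term, `ψ ^ (j - k) * φ` from there on. Only the second needs `ψφ² = φ`.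
  have hc : ∀ j, (ψ ^ (j + 1 - k) * φ ^ (1 + (k - (j + 1)))) * φ =
      ψ ^ (j - k) * φ ^ (1 + (k - j)) := by
    intro j
    rcases le_or_gt k j with hj | hj
    · obtain ⟨d, rfl⟩ := Nat.exists_eq_add_of_le hj
      have e1 : k + d + 1 - k = d + 1 := by omega
      have e2 : k - (k + d + 1) = 0 := by omega
      have e3 : k + d - k = d := by omega
      have e4 : k - (k + d) = 0 := by omega
      rw [e1, e2, e3, e4, Nat.add_zero, pow_one, pow_succ, mul_assoc, mul_assoc, ← mul_assoc ψ, h]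
    · obtain ⟨d, rfl⟩ := Nat.exists_eq_add_of_lt hj
      have e1 : j + 1 - (j + d + 1) = 0 := by omega
      have e2 : j + d + 1 - (j + 1) = d := by omega
      have e3 : j - (j + d + 1) = 0 := by omega
      have e4 : 1 + (j + d + 1 - j) = 1 + d + 1 := by omega
      rw [e1, e2, e3, e4, pow_zero, one_mul, one_mul, pow_succ]
  refine ⟨lift (fun j => ψ ^ (j - k) * φ ^ (1 + (k - j))) fun j x => ?_, fun x => ?_⟩
  · exact LinearMap.congr_fun (hc j) x
  · rw [lift_of]
    simp

/-- On the image of the `k`-th term, the retraction to `F` followed by the map of the next term is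
the identity, since `of φ (k + 1) (φ x) = of φ k x`. -/
theorem projective [Module.Projective A F] {ψ : Module.End A F} (h : ψ * φ * φ = φ) :
    Module.Projective A (Telescope φ) := by
  choose r hr using exists_retraction h
  refine Module.Projective.of_exhaustion (fun k => LinearMap.range (of φ k))
    (monotone_nat_of_le_succ fun k => ?_) (fun z => ?_) r (fun k => of φ (k + 1)) ?_ ?_
  · rintro _ ⟨x, rfl⟩
    exact ⟨φ x, of_succ k x⟩
  · obtain ⟨k, x, h⟩ := exists_of z
    exact ⟨k, x, h⟩
  · rintro k _ ⟨x, rfl⟩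
    rw [hr, of_succ]
  · exact fun k y => ⟨y, rfl⟩

end Telescope

end Telescope

/-! ### The endomorphism of a free module on words. -/

section Words

variable {A : Type u} [Ring A] {n m : ℕ}

/-- The free module on pairs of an index and a word. -/
abbrev WordModule (A : Type u) [Ring A] (n m : ℕ) : Type u := (Fin n × List (Fin m)) →₀ A

/-- The image of a basis vector under `wordShift`. -/
noncomputable def wordShiftBasis (E : Fin n → Fin n → A) (x : Fin m → A) :
    Fin n × List (Fin m) → WordModule A n m
  | (i, []) => ∑ i', Finsupp.single (i', []) (E i i') + ∑ j, Finsupp.single (i, [j]) (x j)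
  | (i, w) => ∑ j, Finsupp.single (i, j :: w) (x j)

/-- The endomorphism acting by the matrix `E` on the coordinates at empty words, and sending a
coordinate `a` at a word `w` to the coordinates `a * x j` at the words `j :: w`. -/
noncomputable def wordShift (E : Fin n → Fin n → A) (x : Fin m → A) :
    Module.End A (WordModule A n m) :=
  Finsupp.linearCombination A (wordShiftBasis E x)

/-- The image of a basis vector under `wordUnshift`. -/
noncomputable def wordUnshiftBasis (c : Fin m → Fin m → Fin m → A)
    (d : Fin n → Fin n → Fin m → Fin m → A) : Fin n × List (Fin m) → WordModule A n m
  | (i, []) => Finsupp.single (i, []) 1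
  | (_, [_]) => 0
  | (i, [l, j]) => ∑ k, Finsupp.single (i, [k]) (c k j l) +
      ∑ i', Finsupp.single (i', []) (d i i' j l)
  | (i, l :: j :: w) => ∑ k, Finsupp.single (i, k :: w) (c k j l)

/-- A left inverse of `wordShift` on its image. -/
noncomputable def wordUnshift (c : Fin m → Fin m → Fin m → A)
    (d : Fin n → Fin n → Fin m → Fin m → A) : Module.End A (WordModule A n m) :=
  Finsupp.linearCombination A (wordUnshiftBasis c d)

theorem single_eq_smul_one {B : Type*} (b : B) (a : A) :
    (Finsupp.single b a : B →₀ A) = a • Finsupp.single b 1 := by simp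

theorem sum_single_mul {B : Type*} {s : Type*} [Fintype s] (b : B) (f : s → A) :
    ∑ i, (Finsupp.single b (f i) : B →₀ A) = Finsupp.single b (∑ i, f i) :=
  (map_sum (Finsupp.singleAddHom b) f Finset.univ).symm

/-- Two shifts of a basis vector at `w` give coefficients `x j * x l` at the words `l :: j :: w`,
from which `c` recovers the `x k` at `k :: w`. At the empty word the matrix `E` contributes its
square; the defect `E - E²` is recovered from the same products through `d`, and the mixed terms at
words of length one are sent to `0`. -/
theorem wordUnshift_mul_wordShift (E : Fin n → Fin n → A) (x : Fin m → A)
    (c : Fin m → Fin m → Fin m → A) (d : Fin n → Fin n → Fin m → Fin m → A)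
    (hc : ∀ k, x k = ∑ j, ∑ l, x j * x l * c k j l)
    (hd : ∀ i i', E i i' - ∑ k, E i k * E k i' = ∑ j, ∑ l, x j * x l * d i i' j l) :
    wordUnshift c d * wordShift E x * wordShift E x = wordShift E x := by
  have hxc : ∀ (i : Fin n) (w : List (Fin m)),
      ∑ j, ∑ l, ∑ k, (Finsupp.single (i, k :: w) (x j * x l * c k j l) : WordModule A n m) =
        ∑ k, Finsupp.single (i, k :: w) (x k) := by
    intro i w
    have h1 : ∀ j, ∑ l, ∑ k, (Finsupp.single (i, k :: w) (x j * x l * c k j l) :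
        WordModule A n m) = ∑ k, ∑ l, Finsupp.single (i, k :: w) (x j * x l * c k j l) :=
      fun j => Finset.sum_comm
    simp_rw [h1]
    rw [Finset.sum_comm]
    refine Finset.sum_congr rfl fun k _ => ?_
    simp_rw [sum_single_mul]
    rw [← hc]
  have hxd : ∀ i : Fin n,
      ∑ j, ∑ l, ∑ i', (Finsupp.single (i', []) (x j * x l * d i i' j l) : WordModule A n m) =
        ∑ i', Finsupp.single (i', []) (E i i' - ∑ k, E i k * E k i') := by
    intro i
    have h1 : ∀ j, ∑ l, ∑ i', (Finsupp.single (i', []) (x j * x l * d i i' j l) :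
        WordModule A n m) = ∑ i', ∑ l, Finsupp.single (i', []) (x j * x l * d i i' j l) :=
      fun j => Finset.sum_comm
    simp_rw [h1]
    rw [Finset.sum_comm]
    refine Finset.sum_congr rfl fun k _ => ?_
    simp_rw [sum_single_mul]
    rw [← hd]
  refine Finsupp.lhom_ext' fun b => LinearMap.ext_ring ?_
  obtain ⟨i, w⟩ := b
  have hE : ∑ k, ∑ i', (Finsupp.single (i', []) (E i k * E k i') : WordModule A n m) =
      ∑ i', Finsupp.single (i', []) (∑ k, E i k * E k i') := by
    rw [Finset.sum_comm]
    exact Finset.sum_congr rfl fun k _ => sum_single_mul _ _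
  match w with
  | [] =>
    simp only [Module.End.mul_apply, LinearMap.comp_apply, Finsupp.lsingle_apply, wordShift,
      wordUnshift, Finsupp.linearCombination_single, one_smul, wordShiftBasis, wordUnshiftBasis,
      map_add, map_sum, smul_add, Finset.smul_sum, Finsupp.smul_single, smul_eq_mul, mul_one,
      Finset.sum_add_distrib, smul_zero, Finset.sum_const_zero, add_zero, hE]
    rw [hxc, hxd]
    simp only [Finsupp.single_sub, Finset.sum_sub_distrib]
    abel
  | [k] =>
    simp only [Module.End.mul_apply, LinearMap.comp_apply, Finsupp.lsingle_apply, wordShift,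
      wordUnshift, Finsupp.linearCombination_single, one_smul, wordShiftBasis, wordUnshiftBasis,
      map_sum, Finset.smul_sum, Finsupp.smul_single, smul_eq_mul]
    exact hxc i [k]
  | k :: k' :: w =>
    simp only [Module.End.mul_apply, LinearMap.comp_apply, Finsupp.lsingle_apply, wordShift,
      wordUnshift, Finsupp.linearCombination_single, one_smul, wordShiftBasis, wordUnshiftBasis,
      map_sum, Finset.smul_sum, Finsupp.smul_single, smul_eq_mul]
    exact hxc i (k :: k' :: w)

theorem wordShift_apply_nil (E : Fin n → Fin n → A) (x : Fin m → A) (v : WordModule A n m)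
    (i' : Fin n) : wordShift E x v (i', []) = ∑ i, v (i, []) * E i i' := by
  induction v using Finsupp.induction_linear with
  | zero => simp
  | add v w hv hw => simp [hv, hw, add_mul, Finset.sum_add_distrib]
  | single b a =>
    obtain ⟨i, w⟩ := b
    cases w with
    | nil => simp [wordShift, wordShiftBasis, Finsupp.single_apply]
    | cons k w => simp [wordShift, wordShiftBasis]

theorem wordShift_apply_cons (E : Fin n → Fin n → A) (x : Fin m → A) (v : WordModule A n m)
    (i : Fin n) (j : Fin m) (w : List (Fin m)) :
    wordShift E x v (i, j :: w) = v (i, w) * x j := by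
  induction v using Finsupp.induction_linear with
  | zero => simp
  | add v w hv hw => simp [hv, hw, add_mul]
  | single b a =>
    obtain ⟨i', w'⟩ := b
    cases w' with
    | nil =>
      by_cases h : i' = i <;> cases w <;>
      simp [wordShift, wordShiftBasis, Finsupp.single_apply, h]
    | cons k w' =>
      by_cases h' : k :: w' = w
      · subst h'
        by_cases h : i' = i <;> simp [wordShift, wordShiftBasis, Finsupp.single_apply, h]
      · simp [wordShift, wordShiftBasis, h']

end Words

/-! ### Lifting projectives modulo an idempotent ideal. -/

section Lifting

variable {A : Type u} [Ring A]

/-- Elements of an idempotent ideal `I` generated by `x` as a right ideal are right linear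
combinations of the products `x j * x l`. -/
theorem exists_eq_sum_mul_mul {I : Ideal A} [I.IsTwoSided] (hII : I * I = I) {m : ℕ}
    {x : Fin m → A} (hx : ∀ a ∈ I, ∃ c : Fin m → A, a = ∑ j, x j * c j) {a : A} (ha : a ∈ I) :
    ∃ c : Fin m → Fin m → A, a = ∑ j, ∑ l, x j * x l * c j l := by
  rw [← hII] at ha
  refine Submodule.mul_induction_on ha (fun b hb b' hb' => ?_) ?_
  · obtain ⟨c, rfl⟩ := hx b hb
    have h : ∀ j, ∃ e : Fin m → A, c j * b' = ∑ l, x l * e l := fun j =>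
      hx _ (I.mul_mem_left _ hb')
    choose e he using h
    exact ⟨e, by simp_rw [Finset.sum_mul, mul_assoc, he, Finset.mul_sum]⟩
  · rintro _ _ ⟨c, rfl⟩ ⟨c', rfl⟩
    exact ⟨c + c', by simp [mul_add, Finset.sum_add_distrib]⟩

/-- The map is only additive, with its semilinearity as a hypothesis, so that `Q` needs no
`A`-module structure of its own. -/
theorem nonempty_quotient_smul_equiv {I : Ideal A} [I.IsTwoSided] {P Q : Type*} [AddCommGroup P]
    [Module A P] [AddCommGroup Q] [Module (A ⧸ I) Q] (τ : P →+ Q)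
    (hτ : ∀ (a : A) z, τ (a • z) = Ideal.Quotient.mk I a • τ z) (hs : Function.Surjective τ)
    (hker : ∀ z, τ z = 0 → z ∈ I • (⊤ : Submodule A P)) :
    Nonempty ((P ⧸ I • (⊤ : Submodule A P)) ≃ₗ[A ⧸ I] Q) := by
  let _ : Module A Q := Module.compHom Q (Ideal.Quotient.mk I)
  let t : P →ₗ[A] Q := { τ with map_smul' := hτ }
  have ht : I • (⊤ : Submodule A P) = LinearMap.ker t := by
    refine le_antisymm (Submodule.smul_le.2 fun a ha z _ => ?_) hker
    exact (hτ a z).trans (by rw [Ideal.Quotient.eq_zero_iff_mem.2 ha, zero_smul])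
  let e := (Submodule.quotEquivOfEq _ _ ht).trans (t.quotKerEquivOfSurjective hs)
  refine ⟨{ e with map_smul' := fun a z => ?_ }⟩
  obtain ⟨a, rfl⟩ := Ideal.Quotient.mk_surjective a
  exact e.map_smul a z

/-- Finitely generated projective modules over `A ⧸ I` lift to countably generated projective
modules over `A`, when `I` is idempotent and finitely generated as a right ideal. -/
theorem exists_projective_lift {I : Ideal A} [I.IsTwoSided] (hII : I * I = I) {m : ℕ}
    {x : Fin m → A} (hxI : ∀ j, x j ∈ I) (hx : ∀ a ∈ I, ∃ c : Fin m → A, a = ∑ j, x j * c j)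
    {n : ℕ} (Q : Type u) [AddCommGroup Q] [Module (A ⧸ I) Q]
    (hQ : IsSummand (A ⧸ I) Q (Fin n → A ⧸ I)) :
    ∃ P : ModuleCat.{u} A, IsCountablyGen A P ∧ Module.Projective A P ∧
      Nonempty ((P ⧸ I • (⊤ : Submodule A P)) ≃ₗ[A ⧸ I] Q) ∧ (0 < n → I ≤ traceOf A P) := by
  obtain ⟨i, p, hpi⟩ := hQ
  have hpi' : ∀ q, p (i q) = q := fun q => LinearMap.congr_fun hpi q
  have hE : ∀ k k' : Fin n, ∃ a : A, Ideal.Quotient.mk I a = i (p (Pi.single k 1)) k' :=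
    fun k k' => Ideal.Quotient.mk_surjective _
  -- `E` lifts the idempotent matrix of `i ∘ p` entrywise; it is idempotent only modulo `I = I * I`,
  -- and `d` writes the defect in the products `x j * x l`.
  choose E hE using hE
  have hEE : ∀ (v : Fin n → A) (k' : Fin n), Ideal.Quotient.mk I (∑ k, v k * E k k') =
      i (p fun k => Ideal.Quotient.mk I (v k)) k' := by
    intro v k'
    have : (fun k => Ideal.Quotient.mk I (v k)) =
        ∑ k, Ideal.Quotient.mk I (v k) • (Pi.single k 1 : Fin n → A ⧸ I) := by
      ext k; simp [Finset.sum_apply, Pi.single_apply]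
    rw [this]
    simp [hE]
  have hc : ∀ k, ∃ c : Fin m → Fin m → A, x k = ∑ j, ∑ l, x j * x l * c j l := fun k =>
    exists_eq_sum_mul_mul hII hx (hxI k)
  have hd : ∀ k k', ∃ d : Fin m → Fin m → A,
      E k k' - ∑ l, E k l * E l k' = ∑ j, ∑ l, x j * x l * d j l := fun k k' => by
    refine exists_eq_sum_mul_mul hII hx ?_
    rw [← Ideal.Quotient.eq_zero_iff_mem, map_sub, hEE (E k) k']
    simp only [hE]
    rw [show (fun l => i (p (Pi.single k 1)) l) = i (p (Pi.single k 1)) from rfl, hpi', sub_self]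
  choose c hc using hc
  choose d hd using hd
  have hφ := wordUnshift_mul_wordShift E x c d hc hd
  set φ : Module.End A (WordModule A n m) := wordShift E x with hφdef
  let _ : Module A Q := Module.compHom Q (Ideal.Quotient.mk I)
  have hsmul : ∀ (a : A) (q : Q), a • q = Ideal.Quotient.mk I a • q := fun _ _ => rfl
  -- Reading the coordinates at empty words modulo `I` is invariant under `φ`, as `E` reduces to `i
  -- ∘ p`. So `t` passes to the direct limit.
  let t : WordModule A n m →ₗ[A] Q :=
    { toFun := fun v => p fun k => Ideal.Quotient.mk I (v (k, []))
      map_add' := fun v w => by rw [← map_add]; congr 1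
      map_smul' := fun a v => by rw [RingHom.id_apply, hsmul, ← map_smul]; congr 1 }
  have htφ : ∀ (k : ℕ) (v : WordModule A n m), t (φ v) = t v := by
    intro _ v
    change p (fun k => Ideal.Quotient.mk I (φ v (k, []))) = p _
    simp only [hφdef, wordShift_apply_nil]
    rw [funext (hEE fun k => v (k, []))]
    exact hpi' _
  let τ : Telescope φ →ₗ[A] Q := Telescope.lift (fun _ => t) htφ
  have hτ : ∀ k v, τ (Telescope.of φ k v) = t v := fun k v => Telescope.lift_of _ htφ k v
  have hker : ∀ z, τ z = 0 → z ∈ I • (⊤ : Submodule A (Telescope φ)) := by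
    intro z hz
    obtain ⟨k, v, rfl⟩ := Telescope.exists_of z
    have hv : t v = 0 := (hτ k v).symm.trans hz
    rw [← Telescope.of_succ]
    -- After one shift, coordinates at nonempty words are multiples of some `x j`, and those at
    -- empty words reduce to `i (t v) = 0`.
    have hmem : φ v ∈ I • (⊤ : Submodule A (WordModule A n m)) := by
      rw [← Finsupp.sum_single (φ v)]
      refine Submodule.sum_mem _ fun b _ => ?_
      change Finsupp.single b (φ v b) ∈ _
      rw [single_eq_smul_one]
      refine Submodule.smul_mem_smul ?_ trivial
      obtain ⟨l, w⟩ := b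
      cases w with
      | nil =>
        rw [hφdef, wordShift_apply_nil, ← Ideal.Quotient.eq_zero_iff_mem,
          hEE fun k => v (k, [])]
        change i (t v) l = 0
        rw [hv, map_zero]
        rfl
      | cons j w =>
        rw [hφdef, wordShift_apply_cons]
        exact I.mul_mem_left _ (hxI j)
    have := Submodule.mem_map_of_mem (f := Telescope.of φ (k + 1)) hmem
    rw [Submodule.map_smul''] at this
    exact Submodule.smul_mono le_rfl le_top this
  have hτs : Function.Surjective τ := by
    intro q
    have h : ∀ k, ∃ a : A, Ideal.Quotient.mk I a = i q k := fun k =>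
      Ideal.Quotient.mk_surjective _
    choose v hv using h
    refine ⟨Telescope.of φ 0 (∑ k, Finsupp.single (k, []) (v k)), ?_⟩
    rw [hτ]
    have : (fun k => Ideal.Quotient.mk I
        ((∑ k, Finsupp.single (k, []) (v k) : WordModule A n m) (k, []))) = i q := by
      ext k
      rw [← hv k]
      simp [Finsupp.single_apply]
    change p (fun k => _) = q
    rw [this, hpi']
  refine ⟨ModuleCat.of A (Telescope φ), ?_, Telescope.projective hφ, ?_, fun hn => ?_⟩
  · refine Telescope.isCountablyGen ⟨Set.range fun b => Finsupp.single b 1,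
      Set.countable_range _, ?_⟩
    exact (Finsupp.basisSingleOne (R := A)).span_eq ▸ by simp
  · exact nonempty_quotient_smul_equiv (P := ModuleCat.of A (Telescope φ)) τ.toAddMonoidHom
      (fun a z => τ.map_smul a z) hτs fun z hz => hker z hz
  -- The retraction carries a basis vector at the empty word to its shift, whose coordinate at `[j]`
  -- is the generator `x j`; thus each `x j` is a value of a functional.
  · obtain ⟨r, hr⟩ := Telescope.exists_retraction hφ 0
    intro a ha
    obtain ⟨c, rfl⟩ := hx a ha
    refine Ideal.sum_mem _ fun j _ => Ideal.mul_mem_right _ _ ?_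
    have := apply_mem_traceOf (Finsupp.lapply (⟨0, hn⟩, [j]) ∘ₗ r)
      (Telescope.of φ 0 (Finsupp.single (⟨0, hn⟩, []) 1))
    rwa [LinearMap.comp_apply, hr, Finsupp.lapply_apply, hφdef, wordShift_apply_cons,
      Finsupp.single_eq_same, one_mul] at this

end Lifting

/-! ### Prime artinian rings and the density theorem. -/

section PrimeRings

open scoped TensorProduct nonZeroDivisors

/-- A noncommutative ring is prime if `a B b = 0` implies `a = 0` or `b = 0`. -/
def HasPrimeProduct (B : Type*) [Ring B] : Prop :=
  ∀ a b : B, (∀ c, a * c * b = 0) → a = 0 ∨ b = 0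

/-- The Jacobson radical `J` is nilpotent. If `J ^ (n + 1) = 0` and `0 ≠ b ∈ J`, then `a B b = 0`
for all `a ∈ J ^ n`, so `J ^ n = 0`; descending to `J ^ 0` leaves only the zero ring. -/
theorem HasPrimeProduct.isSemisimpleRing {B : Type*} [Ring B] [IsArtinianRing B]
    (h : HasPrimeProduct B) : IsSemisimpleRing B := by
  rw [IsArtinianRing.isSemisimpleRing_iff_jacobson, ← Ideal.jacobson_bot]
  have hnil := IsArtinianRing.isNilpotent_jacobson_bot (R := B)
  set J : Ideal B := (⊥ : Ideal B).jacobson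
  have hsq : ∀ n, J ^ n = ⊥ → J = ⊥ ∨ (1 : Ideal B) = ⊥ := by
    intro n
    induction n with
    | zero => exact fun h => Or.inr (by rwa [Submodule.pow_zero] at h)
    | succ n ih =>
      intro hn
      by_cases h0 : J = ⊥
      · exact Or.inl h0
      obtain ⟨b, hb, hb0⟩ := (Submodule.ne_bot_iff J).1 h0
      refine ih ((Submodule.eq_bot_iff _).2 fun a ha => ?_)
      refine (h a b fun c => ?_).resolve_right hb0
      have : a * (c * b) ∈ J ^ (n + 1) := by
        rw [Submodule.pow_succ]
        exact Ideal.mul_mem_mul ha (J.mul_mem_left c hb)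
      rw [hn] at this
      rw [mul_assoc]
      exact this
  obtain ⟨n, hn⟩ := hnil
  rcases hsq n hn with h | h
  · exact h
  · refine (Submodule.eq_bot_iff _).2 fun x _ => ?_
    have h1 : (1 : B) ∈ (⊥ : Ideal B) := h ▸ Ideal.one_eq_top (R := B) ▸ trivial
    rw [← mul_one x, (Submodule.mem_bot B).1 h1, mul_zero]

/-- A prime artinian ring is simple. -/
theorem HasPrimeProduct.eq_top_of_ne_bot {B : Type*} [Ring B] [IsArtinianRing B]
    (h : HasPrimeProduct B) {N : Ideal B} [N.IsTwoSided] (hN : N ≠ ⊥) : N = ⊤ := by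
  have := h.isSemisimpleRing
  obtain ⟨N', hN'⟩ := exists_isCompl N
  obtain ⟨a, ha, ha0⟩ := (Submodule.ne_bot_iff N).1 hN
  -- For a left ideal complement `N'` of `N`, the product `N B N'` lies in `N ∩ N' = 0`.
  have : N' = ⊥ := by
    refine (Submodule.eq_bot_iff _).2 fun b hb => ?_
    refine (h a b fun c => ?_).resolve_left ha0
    have : a * c * b ∈ N ⊓ N' :=
      ⟨N.mul_mem_right _ (N.mul_mem_right _ ha), N'.mul_mem_left _ hb⟩
    rwa [hN'.inf_eq_bot] at this
  rw [← sup_bot_eq N, ← this, hN'.sup_eq_top]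

/-- In a finite dimensional prime central algebra, linear functionals are given by multiplications
on both sides. -/
theorem exists_tensor_apply_eq {K D : Type*} [Field K] [Ring D] [Algebra K D] [Module.Finite K D]
    (hD : HasPrimeProduct D) (hc : ∀ z : D, (∀ x, z * x = x * z) → ∃ k, algebraMap K D k = z)
    (f : D →ₗ[K] K) :
    ∃ r : D ⊗[K] Dᵐᵒᵖ, ∀ x, AlgHom.mulLeftRight K D r x = algebraMap K D (f x) := by
  rcases subsingleton_or_nontrivial D with hs | hnt
  · exact ⟨0, fun x => Subsingleton.elim _ _⟩
  have : IsArtinianRing D := isArtinian_of_tower K inferInstance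
  let _ := instModuleTensorProductMop K D
  have hsmul : ∀ (a b x : D), (a ⊗ₜ[K] MulOpposite.op b) • x = a * x * b := fun a b x =>
    AlgHom.mulLeftRight_apply K D a (MulOpposite.op b) x
  have hrs : ∀ (r : D ⊗[K] Dᵐᵒᵖ) (x : D), r • x = AlgHom.mulLeftRight K D r x := fun r x => rfl
  have : IsSimpleModule (D ⊗[K] Dᵐᵒᵖ) D := by
    rw [isSimpleModule_iff]
    refine { exists_pair_ne := ⟨⊥, ⊤, bot_ne_top⟩, eq_bot_or_eq_top := fun N => ?_ }
    let I : Ideal D :=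
      { N.toAddSubmonoid with
        smul_mem' := fun a x hx => by
          have := N.smul_mem (a ⊗ₜ[K] MulOpposite.op 1) hx
          rwa [hsmul, mul_one] at this }
    have hI : I.IsTwoSided := ⟨fun {x} b hx => by
      have := N.smul_mem (1 ⊗ₜ[K] MulOpposite.op b) hx
      rwa [hsmul, one_mul] at this⟩
    by_cases h : I = ⊥
    · left
      refine (Submodule.eq_bot_iff _).2 fun x hx => ?_
      have : x ∈ I := hx
      rwa [h] at this
    · right
      refine eq_top_iff.2 fun x _ => ?_
      have : x ∈ I := by rw [hD.eq_top_of_ne_bot h]; trivial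
      exact this
  -- A bimodule endomorphism is multiplication by the central element `g 1`. Since the commutant is
  -- `K`, the density theorem realizes every `K`-linear map on the finite generating set `s`.
  have hend : ∀ g : Module.End (D ⊗[K] Dᵐᵒᵖ) D, ∃ k : K, ∀ x, g x = k • x := by
    intro g
    have hl : ∀ a x, g (a * x) = a * g x := fun a x => by
      have := g.map_smul (a ⊗ₜ[K] MulOpposite.op 1) x
      rwa [hsmul, hsmul, mul_one, mul_one] at this
    have hr : ∀ b x, g (x * b) = g x * b := fun b x => by
      have := g.map_smul (1 ⊗ₜ[K] MulOpposite.op b) x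
      rwa [hsmul, hsmul, one_mul, one_mul] at this
    obtain ⟨k, hk⟩ := hc (g 1) fun x => by rw [← hr, ← hl, one_mul, mul_one]
    refine ⟨k, fun x => ?_⟩
    rw [← one_mul x, hr, ← hk, Algebra.smul_def, one_mul]
  let F : Module.End (Module.End (D ⊗[K] Dᵐᵒᵖ) D) D :=
    { toFun := fun x => algebraMap K D (f x)
      map_add' := fun x y => by rw [map_add, map_add]
      map_smul' := fun g x => by
        obtain ⟨k, hk⟩ := hend g
        rw [Module.End.smul_def, Module.End.smul_def, RingHom.id_apply, hk, hk, map_smul,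
          smul_eq_mul, map_mul, Algebra.smul_def] }
  obtain ⟨s, hs⟩ := Module.Finite.fg_top (R := K) (M := D)
  obtain ⟨r, hr⟩ := jacobson_density F s
  refine ⟨r, fun x => ?_⟩
  have hx : x ∈ Submodule.span K (s : Set D) := hs ▸ trivial
  refine LinearMap.eqOn_span (f := AlgHom.mulLeftRight K D r)
    (g := (Algebra.linearMap K D) ∘ₗ f) (fun y hy => ?_) hx
  rw [← hrs, ← hr y hy]
  rfl

end PrimeRings

/-! ### Central elements in ideals of prime rings. -/

section CentralElements

open scoped TensorProduct nonZeroDivisors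

variable {C B : Type*} [CommRing C] [Ring B] [Algebra C B]

/-- In a prime ring `B` which is finite over its center `C`, some nonzero central element `s`
multiplies every two-sided ideal `J` into the ideal generated by `J ∩ C`. -/
theorem exists_central_smul_mem (K : Type*) [Field K] [Algebra C K] [IsFractionRing C K]
    [IsDomain C] [Module.Finite C B] (hinj : Function.Injective (algebraMap C B))
    (hB : HasPrimeProduct B) (hc : ∀ z : B, (∀ x, z * x = x * z) → ∃ k, algebraMap C B k = z) :
    ∃ s : C, s ≠ 0 ∧ ∀ (J : Ideal B) [J.IsTwoSided], ∀ b ∈ J,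
      s • b ∈ (J.comap (algebraMap C B)).map (algebraMap C B) := by
  classical
  let D := K ⊗[C] B
  have hcen : ∀ (c : C) (x : B), algebraMap C B c * x = x * algebraMap C B c := Algebra.commutes
  have htf : ∀ (c : C) (b : B), c ≠ 0 → c • b = 0 → b = 0 := by
    intro c b h0 hb
    refine (hB (algebraMap C B c) b fun x => ?_).resolve_left fun h =>
      h0 (hinj (h.trans (map_zero _).symm))
    rw [hcen, mul_assoc, ← Algebra.smul_def, hb, mul_zero]
  let ι : B →ₐ[C] D := Algebra.TensorProduct.includeRight
  have hloc : IsLocalizedModule C⁰ (TensorProduct.mk C K B 1) := inferInstance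
  have hιinj : Function.Injective ι := by
    refine (injective_iff_map_eq_zero ι).2 fun b hb => ?_
    obtain ⟨c, hc⟩ := (IsLocalizedModule.eq_zero_iff C⁰ (TensorProduct.mk C K B 1)).1 hb
    exact htf c b (nonZeroDivisors.ne_zero c.2) hc
  have hsurj : ∀ x : D, ∃ (c : C) (b : B), c ≠ 0 ∧ c • x = ι b := by
    intro x
    obtain ⟨⟨b, c⟩, h⟩ := IsLocalizedModule.surj C⁰ (TensorProduct.mk C K B 1) x
    exact ⟨c, b, nonZeroDivisors.ne_zero c.2, h⟩
  have hunit : ∀ (c : C) (x y : D), c ≠ 0 → c • x = c • y → x = y := by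
    intro c x y h0 h
    rw [← algebraMap_smul K c x, ← algebraMap_smul K c y] at h
    exact smul_right_injective D
      ((map_ne_zero_iff _ (IsFractionRing.injective C K)).2 h0) h
  have hsd : ∀ (k : K) (x : D), k • x = algebraMap K D k * x := Algebra.smul_def
  have hD : HasPrimeProduct D := by
    intro x y h
    obtain ⟨c, b, hc0, hb⟩ := hsurj x
    obtain ⟨c', b', hc0', hb'⟩ := hsurj y
    have : b = 0 ∨ b' = 0 := hB b b' fun z => hιinj (by
      rw [map_mul, map_mul, ← hb, ← hb', map_zero, smul_mul_assoc, smul_mul_assoc,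
        mul_smul_comm, h, smul_zero, smul_zero])
    refine this.imp (fun h => hunit c _ _ hc0 ?_) (fun h => hunit c' _ _ hc0' ?_)
    · rw [hb, h, map_zero, smul_zero]
    · rw [hb', h, map_zero, smul_zero]
  have hcD : ∀ z : D, (∀ x, z * x = x * z) → ∃ k, algebraMap K D k = z := by
    intro z hz
    obtain ⟨c, b, hc0, hb⟩ := hsurj z
    obtain ⟨k, rfl⟩ := hc b fun x => hιinj (by
      rw [map_mul, map_mul, ← hb, smul_mul_assoc, hz, mul_smul_comm])
    refine ⟨algebraMap C K k / algebraMap C K c, hunit c _ _ hc0 ?_⟩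
    rw [hb, ← algebraMap_smul K c, hsd, ← map_mul, mul_div_cancel₀ _
      ((map_ne_zero_iff _ (IsFractionRing.injective C K)).2 hc0), AlgHom.commutes]
    exact (IsScalarTower.algebraMap_apply C K D k).symm
  -- Clearing the denominators of `r`: up to a factor `s` independent of `b` and `J`, two-sided
  -- multiplication by `r` keeps elements of `J` in `J`.
  have hten : ∀ r : D ⊗[K] Dᵐᵒᵖ, ∃ s : C, s ≠ 0 ∧ ∀ b : B, ∃ z : B,
      (∀ (J : Ideal B) [J.IsTwoSided], b ∈ J → z ∈ J) ∧
      s • AlgHom.mulLeftRight K D r (ι b) = ι z := by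
    intro r
    induction r using TensorProduct.induction_on with
    | zero => exact ⟨1, one_ne_zero, fun b => ⟨0, fun J _ _ => J.zero_mem, by simp⟩⟩
    | tmul x y =>
      obtain ⟨c, u, hc0, hu⟩ := hsurj x
      obtain ⟨c', v, hc0', hv⟩ := hsurj y.unop
      refine ⟨c * c', mul_ne_zero hc0 hc0', fun b => ⟨u * b * v, fun J _ hb =>
        J.mul_mem_right _ (J.mul_mem_left _ hb), ?_⟩⟩
      rw [AlgHom.mulLeftRight_apply, map_mul, map_mul, ← hu, ← hv, mul_smul, smul_mul_assoc,
        smul_mul_assoc, mul_smul_comm]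
    | add r r' h h' =>
      obtain ⟨s, hs0, hs⟩ := h
      obtain ⟨s', hs0', hs'⟩ := h'
      refine ⟨s * s', mul_ne_zero hs0 hs0', fun b => ?_⟩
      obtain ⟨z, hz, hzb⟩ := hs b
      obtain ⟨z', hz', hzb'⟩ := hs' b
      refine ⟨s' • z + s • z', fun J _ hb => ?_, ?_⟩
      · rw [Algebra.smul_def, Algebra.smul_def]
        exact J.add_mem (J.mul_mem_left _ (hz J hb)) (J.mul_mem_left _ (hz' J hb))
      · rw [map_add, LinearMap.add_apply, smul_add, map_add, map_smul, map_smul, ← hzb, ← hzb',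
          smul_smul, smul_smul, mul_comm s s']
  -- The goal is `T s` for the identity of `D`, which is a finite sum of the rank-one maps
  -- `f.smulRight e`.
  let T (s : C) (f : D →ₗ[K] D) : Prop := s ≠ 0 ∧ ∀ (J : Ideal B) [J.IsTwoSided], ∀ b ∈ J,
    ∃ w ∈ (J.comap (algebraMap C B)).map (algebraMap C B), s • f (ι b) = ι w
  have hrank : ∀ (f : D →ₗ[K] K) (e : D), ∃ s, T s (f.smulRight e) := by
    intro f e
    obtain ⟨r, hr⟩ := exists_tensor_apply_eq hD hcD f
    obtain ⟨s, hs0, hs⟩ := hten r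
    obtain ⟨c, β, hc0, hβ⟩ := hsurj e
    refine ⟨s * c, mul_ne_zero hs0 hc0, fun J _ b hb => ?_⟩
    obtain ⟨z, hz, hzb⟩ := hs b
    rw [hr] at hzb
    -- The element `z ∈ J` equals `s • f (ι b)` with `f (ι b)` a scalar, so it is central and lies
    -- in `J ∩ C`.
    obtain ⟨k, rfl⟩ := hc z fun x => hιinj (by
      rw [map_mul, map_mul, ← hzb, smul_mul_assoc, Algebra.commutes, mul_smul_comm])
    refine ⟨β * algebraMap C B k, Ideal.mul_mem_left _ _
      (Ideal.mem_map_of_mem _ (hz J hb)), ?_⟩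
    rw [← hcen, map_mul, ← hzb, ← hβ, LinearMap.smulRight_apply, mul_smul, smul_mul_smul_comm,
      smul_smul, hsd]
  have hsum : ∀ {t : Type} [Fintype t] (f : t → D →ₗ[K] D), (∀ i, ∃ s, T s (f i)) →
      ∃ s, T s (∑ i, f i) := by
    intro t _ f hf
    choose s hs0 hs using hf
    refine ⟨∏ i, s i, Finset.prod_ne_zero_iff.2 fun i _ => hs0 i, fun J _ b hb => ?_⟩
    choose w hw hwb using fun i => hs i J b hb
    refine ⟨∑ i, (∏ j ∈ Finset.univ.erase i, s j) • w i, Ideal.sum_mem _ fun i _ => ?_, ?_⟩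
    · rw [Algebra.smul_def]
      exact Ideal.mul_mem_left _ _ (hw i)
    · rw [LinearMap.sum_apply, Finset.smul_sum, map_sum]
      refine Finset.sum_congr rfl fun i _ => ?_
      rw [map_smul, ← hwb, smul_smul, Finset.prod_erase_mul _ _ (Finset.mem_univ i)]
  let e := Module.finBasis K D
  obtain ⟨s, hs0, hs⟩ := hsum (fun i => (e.coord i).smulRight (e i)) fun i => hrank _ _
  refine ⟨s, hs0, fun J _ b hb => ?_⟩
  obtain ⟨w, hw, hwb⟩ := hs J b hb
  have h1 : (∑ i, (e.coord i).smulRight (e i)) (ι b) = ι b := by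
    rw [LinearMap.sum_apply]
    exact e.sum_repr (ι b)
  rw [h1, ← map_smul] at hwb
  rwa [hιinj hwb]

/-- If `J ≤ I J` and `s` multiplies `I` into the ideal generated by its central elements, then a
power of `s` lies in `I`. -/
theorem exists_pow_mem_of_le_mul [IsNoetherianRing C] [Module.Finite C B]
    (hinj : Function.Injective (algebraMap C B)) (hB : HasPrimeProduct B)
    {I J : Ideal B} (hJ : J ≠ ⊥) (hIJ : J ≤ I * J) {s : C}
    (hs : ∀ b ∈ I, s • b ∈ (I.comap (algebraMap C B)).map (algebraMap C B)) :
    ∃ N : ℕ, algebraMap C B s ^ N ∈ I := by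
  set 𝔡 : Ideal C := I.comap (algebraMap C B) with h𝔡
  let M : Submodule C B := J.restrictScalars C
  -- `sJ ≤ sIJ ≤ (𝔡B)J ≤ 𝔡J`.
  have hmem : ∀ j ∈ J, s • j ∈ 𝔡 • M := by
    intro j hj
    refine Submodule.mul_induction_on (hIJ hj) (fun u hu v hv => ?_) fun x y hx hy => ?_
    · rw [← smul_mul_assoc]
      refine Submodule.span_induction (p := fun x _ => x * v ∈ 𝔡 • M) ?_ ?_ ?_ ?_ (hs u hu)
      · rintro _ ⟨z, hz, rfl⟩
        rw [← Algebra.smul_def]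
        exact Submodule.smul_mem_smul hz hv
      · rw [zero_mul]; exact Submodule.zero_mem _
      · intro x y _ _ hx hy
        rw [add_mul]; exact Submodule.add_mem _ hx hy
      · intro a x _ hx
        rw [smul_eq_mul, mul_assoc]
        have : (𝔡 • M).map (LinearMap.mulLeft C a) ≤ 𝔡 • M := by
          rw [Submodule.map_smul'']
          refine Submodule.smul_mono le_rfl ?_
          rintro _ ⟨y, hy, rfl⟩
          exact J.mul_mem_left a hy
        exact this ⟨_, hx, rfl⟩
    · rw [smul_add]; exact Submodule.add_mem _ hx hy
  have hrange : LinearMap.range (s • (1 : Module.End C M)) ≤ 𝔡 • ⊤ := by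
    rintro _ ⟨y, rfl⟩
    have h1 : s • y.1 ∈ Submodule.map M.subtype (𝔡 • ⊤) := by
      rw [Submodule.map_smul'', Submodule.map_top, Submodule.range_subtype]
      exact hmem y.1 y.2
    obtain ⟨z, hz, hzy⟩ := h1
    have : z = (s • (1 : Module.End C M)) y := Subtype.ext hzy
    rw [← this]
    exact hz
  have : IsNoetherian C B := isNoetherian_of_isNoetherianRing_of_finite C B
  -- Cayley–Hamilton for multiplication by `s` on `J`: a monic `p` with non-leading coefficients in
  -- `𝔡` annihilates it. As `B` is prime and `J ≠ 0`, already `p(s) = 0`, so the leading power of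
  -- `s` lies in `𝔡`.
  obtain ⟨p, hp, -, hpc, hp0⟩ :=
    LinearMap.exists_monic_and_natDegree_eq_and_coeff_mem_pow_and_aeval_eq_zero C
      (s • (1 : Module.End C M)) 𝔡 hrange
  have heval : p.eval s = 0 := by
    obtain ⟨j, hj, hj0⟩ := (Submodule.ne_bot_iff J).1 hJ
    have h1 : p.eval s • j = 0 := by
      have h2 : s • (1 : Module.End C M) = algebraMap C (Module.End C M) s :=
        (Algebra.algebraMap_eq_smul_one s).symm
      rw [h2, Polynomial.aeval_algebraMap_apply_eq_algebraMap_eval] at hp0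
      have := LinearMap.congr_fun hp0 (⟨j, hj⟩ : M)
      exact congrArg Subtype.val this
    have h3 := (hB (algebraMap C B (p.eval s)) j fun x => by
      rw [Algebra.commutes, mul_assoc, ← Algebra.smul_def, h1, mul_zero]).resolve_right hj0
    exact hinj (h3.trans (map_zero _).symm)
  refine ⟨p.natDegree, ?_⟩
  have hsd : s ^ p.natDegree ∈ 𝔡 := by
    rw [Polynomial.eval_eq_sum_range, Finset.sum_range_succ, hp.coeff_natDegree, one_mul] at heval
    rw [eq_neg_of_add_eq_zero_right heval]
    refine 𝔡.neg_mem (Ideal.sum_mem _ fun k hk => 𝔡.mul_mem_right _ ?_)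
    have hk := Finset.mem_range.1 hk
    exact Ideal.pow_le_self (by omega) (hpc k)
  rw [← map_pow]
  exact hsd

end CentralElements

/-! ### Stationarity of chains of weakly idempotent ideals. -/

section Chains

/-- The central element of a prime ring used for chains of ideals, without reference to the
center as a base ring. -/
theorem exists_central_pow_mem {R B : Type*} [CommRing R] [IsNoetherianRing R] [Ring B]
    [Algebra R B] [Module.Finite R B] [Nontrivial B] (hB : HasPrimeProduct B) :
    ∃ s : B, s ≠ 0 ∧ (∀ x, s * x = x * s) ∧
      ∀ (I J : Ideal B) [I.IsTwoSided], J ≠ ⊥ → J ≤ I * J → ∃ N : ℕ, s ^ N ∈ I := by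
  let C := Subring.center B
  have hinj : Function.Injective (algebraMap C B) := Subtype.val_injective
  have hcen : ∀ z : C, ∀ x : B, (z : B) * x = x * z := fun z x =>
    (Subring.mem_center_iff.1 z.2 x).symm
  have hdom : IsDomain C := by
    have : NoZeroDivisors C := ⟨fun {a b} hab => by
      refine (hB a b fun c => ?_).imp (fun h => Subtype.ext h) fun h => Subtype.ext h
      rw [hcen, mul_assoc]
      have : (a : B) * b = 0 := congrArg Subtype.val hab
      rw [this, mul_zero]⟩
    exact NoZeroDivisors.to_isDomain C
  let f : R →+* C := (algebraMap R B).codRestrict C fun r =>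
    Subring.mem_center_iff.2 fun x => (Algebra.commutes r x).symm
  let _ : Algebra R C := f.toAlgebra
  have htower : IsScalarTower R C B := IsScalarTower.of_algebraMap_eq fun _ => rfl
  have hRB : IsNoetherian R B := isNoetherian_of_isNoetherianRing_of_finite R B
  have hRC : IsNoetherian R C :=
    isNoetherian_of_injective (IsScalarTower.toAlgHom R C B).toLinearMap hinj
  have hC : IsNoetherianRing C := isNoetherian_of_tower R hRC
  have hfin : Module.Finite C B := Module.Finite.of_restrictScalars_finite R C B
  obtain ⟨s, hs0, hs⟩ := exists_central_smul_mem (FractionRing C) hinj hB fun z hz =>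
    ⟨⟨z, Subring.mem_center_iff.2 fun x => (hz x).symm⟩, rfl⟩
  exact ⟨s, fun h => hs0 (Subtype.ext h), hcen s, fun I J _ hJ hIJ =>
    exists_pow_mem_of_le_mul hinj hB hJ hIJ (hs I)⟩

theorem Ideal.map_mul_le {A B : Type*} [Ring A] [Ring B] (f : A →+* B) (I J : Ideal A) :
    (I * J).map f ≤ I.map f * J.map f := by
  refine Ideal.map_le_iff_le_comap.2 (Submodule.smul_le.2 fun a ha b hb => ?_)
  rw [Ideal.mem_comap, smul_eq_mul, map_mul]
  exact Ideal.mul_mem_mul (Ideal.mem_map_of_mem f ha) (Ideal.mem_map_of_mem f hb)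

/-- In the situation of a prime ring, weakly idempotent ideals that agree modulo `s` agree. -/
theorem le_of_le_sup_span {B : Type*} [Ring B] {s : B} (hs : ∀ x, s * x = x * s)
    {I J K : Ideal B} [J.IsTwoSided] {N : ℕ} (hN : s ^ N ∈ J) (hI : I ≤ K * I)
    (hK : ∀ x ∈ K, ∃ y, x - s * y ∈ J) : I ≤ J := by
  have hpow : ∀ n (x : B), s ^ n * x = x * s ^ n := fun n x =>
    ((show Commute s x from hs x).pow_left n)
  -- `I ≤ KI ≤ (J + sB)I ≤ J + sI`. Iterating reaches `J + s ^ N I`, which is contained in `J`.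
  have step : ∀ x ∈ I, ∃ y ∈ I, x - s * y ∈ J := by
    intro x hx
    refine Submodule.mul_induction_on (hI hx) (fun u hu v hv => ?_) ?_
    · obtain ⟨y, hy⟩ := hK u hu
      refine ⟨y * v, I.mul_mem_left _ hv, ?_⟩
      rw [← mul_assoc, ← sub_mul]
      exact J.mul_mem_right _ hy
    · rintro x x' ⟨y, hy, h⟩ ⟨y', hy', h'⟩
      refine ⟨y + y', I.add_mem hy hy', ?_⟩
      have := J.add_mem h h'
      rwa [sub_add_sub_comm, ← mul_add] at this
  have iter : ∀ n, ∀ x ∈ I, ∃ y ∈ I, x - s ^ n * y ∈ J := by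
    intro n
    induction n with
    | zero => exact fun x hx => ⟨x, hx, by simp⟩
    | succ n ih =>
      intro x hx
      obtain ⟨y, hy, h⟩ := ih x hx
      obtain ⟨z, hz, h'⟩ := step y hy
      refine ⟨z, hz, ?_⟩
      have := J.add_mem h (J.mul_mem_left (s ^ n) h')
      rwa [mul_sub, ← mul_assoc, ← pow_succ, sub_add_sub_cancel] at this
  intro x hx
  obtain ⟨y, -, h⟩ := iter N x hx
  have := J.add_mem h (hpow N y ▸ J.mul_mem_left y hN : s ^ N * y ∈ J)
  rwa [sub_add_cancel] at this

/-- Descending chains of two-sided ideals with `I (k + 1) ≤ I k * I (k + 1)` are stationary modulo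
every two-sided ideal, in a module-finite algebra over a commutative noetherian ring. -/
theorem exists_forall_le_sup {R A : Type*} [CommRing R] [IsNoetherianRing R] [Ring A]
    [Algebra R A] [Module.Finite R A] (I : ℕ → Ideal A) (hI : ∀ k, (I k).IsTwoSided)
    (hanti : Antitone I) (hmul : ∀ k, I (k + 1) ≤ I k * I (k + 1)) (J : Ideal A)
    (hJ : J.IsTwoSided) : ∃ k, ∀ m, I k ≤ I m ⊔ J := by
  have hnoeth : IsNoetherianRing A := IsNoetherianRing.of_finite R A
  induction J using WellFoundedGT.induction with
  | ind J ih =>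
  by_cases htop : J = ⊤
  · exact ⟨0, fun m => by rw [htop, sup_top_eq]; exact le_top⟩
  by_cases hprime : ∀ a b, (∀ c, a * c * b ∈ J) → a ∈ J ∨ b ∈ J
  -- Prime case: the induction hypothesis is applied to the preimage `H` of the ideal generated by
  -- `s`, which is strictly larger than `J` because `s ≠ 0`.
  · let π := Ideal.Quotient.mk J
    have hπs : Function.Surjective π := Ideal.Quotient.mk_surjective
    have : Nontrivial (A ⧸ J) := Ideal.Quotient.nontrivial_iff.2 htop
    have hB : HasPrimeProduct (A ⧸ J) := by
      intro a b h
      obtain ⟨a, rfl⟩ := hπs a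
      obtain ⟨b, rfl⟩ := hπs b
      refine (hprime a b fun c => ?_).imp Ideal.Quotient.eq_zero_iff_mem.2
        Ideal.Quotient.eq_zero_iff_mem.2
      rw [← Ideal.Quotient.eq_zero_iff_mem, map_mul, map_mul]
      exact h _
    obtain ⟨s, hs0, hsc, hs⟩ := exists_central_pow_mem (R := R) hB
    by_cases hz : ∃ k, I k ≤ J
    · obtain ⟨k, hk⟩ := hz
      exact ⟨k, fun m => hk.trans le_sup_right⟩
    have hLts : ∀ k, ((I k).map π).IsTwoSided := fun k => ⟨fun {x} b hx => by
      obtain ⟨x, hx', rfl⟩ := (Ideal.mem_map_iff_of_surjective π hπs).1 hx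
      obtain ⟨b, rfl⟩ := hπs b
      rw [← map_mul]
      exact Ideal.mem_map_of_mem π ((I k).mul_mem_right _ hx')⟩
    have hLmul : ∀ k, (I (k + 1)).map π ≤ (I k).map π * (I (k + 1)).map π := fun k =>
      (Ideal.map_mono (hmul k)).trans (Ideal.map_mul_le π _ _)
    have hL0 : ∀ k, (I k).map π ≠ ⊥ := by
      intro k h0
      refine hz ⟨k, fun x hx => ?_⟩
      have := Ideal.mem_map_of_mem π hx
      rw [h0] at this
      exact Ideal.Quotient.eq_zero_iff_mem.1 this
    have hpow : ∀ k, ∃ N : ℕ, s ^ N ∈ (I k).map π := fun k => hs _ _ (hL0 _) (hLmul k)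
    let H : Ideal A := (Ideal.span {s}).comap π
    have hsp : ∀ x, x ∈ Ideal.span {s} ↔ ∃ y, y * s = x := fun x => Ideal.mem_span_singleton'
    have hHts : H.IsTwoSided := ⟨fun {x} b hx => by
      obtain ⟨y, hy⟩ := (hsp _).1 hx
      refine (hsp _).2 ⟨y * π b, ?_⟩
      rw [map_mul, ← hy, mul_assoc, mul_assoc, hsc]⟩
    have hJH : J < H := by
      refine lt_of_le_of_ne (fun x hx => ?_) fun h => ?_
      · refine (hsp _).2 ⟨0, ?_⟩
        rw [zero_mul]
        exact (Ideal.Quotient.eq_zero_iff_mem.2 hx).symm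
      · obtain ⟨t, ht⟩ := hπs s
        have : t ∈ H := (hsp _).2 ⟨1, by rw [one_mul, ht]⟩
        rw [← h] at this
        exact hs0 (ht ▸ Ideal.Quotient.eq_zero_iff_mem.2 this)
    obtain ⟨k, hk⟩ := ih H hJH hHts
    refine ⟨k + 1, fun m => ?_⟩
    obtain ⟨N, hN⟩ := hpow m
    have hle : (I (k + 1)).map π ≤ (I m).map π := by
      refine le_of_le_sup_span hsc hN (hLmul k) fun x hx => ?_
      obtain ⟨x, hx', rfl⟩ := (Ideal.mem_map_iff_of_surjective π hπs).1 hx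
      obtain ⟨a, ha, b, hb, rfl⟩ := Submodule.mem_sup.1 (hk m hx')
      obtain ⟨y, hy⟩ := (hsp _).1 hb
      refine ⟨y, ?_⟩
      rw [hsc, hy, map_add, add_sub_cancel_right]
      exact Ideal.mem_map_of_mem π ha
    refine (Ideal.map_le_iff_le_comap.1 hle).trans ?_
    rw [Ideal.comap_map_of_surjective π hπs]
    refine sup_le_sup_left (fun x hx => ?_) _
    exact Ideal.Quotient.eq_zero_iff_mem.1 hx
  · push Not at hprime
    obtain ⟨a, b, hab, ha, hb⟩ := hprime
    -- Otherwise there are two-sided ideals `J₁ ∋ a` and `J₂ ∋ b`, strictly larger than `J`, with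
    -- `J₁ J₂ ≤ J`. If the chain is stationary modulo both from `k` on, then `I (k+1) ≤ I k * I
    -- (k+1) ≤ (I m + J₁)(I m + J₂) ≤ I m + J`.
    let J₁ : Ideal A :=
      { carrier := {x | ∀ c, x * c * b ∈ J}
        add_mem' := fun {x y} hx hy c => by
          rw [add_mul, add_mul]; exact J.add_mem (hx c) (hy c)
        zero_mem' := fun c => by rw [zero_mul, zero_mul]; exact J.zero_mem
        smul_mem' := fun r x hx c => by
          rw [smul_eq_mul, mul_assoc, mul_assoc, ← mul_assoc x]; exact J.mul_mem_left _ (hx c) }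
    have hJ₁ : J₁.IsTwoSided := ⟨fun {x} r hx c => by rw [mul_assoc x]; exact hx _⟩
    let J₂ : Ideal A :=
      { carrier := {y | ∀ x ∈ J₁, x * y ∈ J}
        add_mem' := fun {y z} hy hz x hx => by
          rw [mul_add]; exact J.add_mem (hy x hx) (hz x hx)
        zero_mem' := fun x _ => by rw [mul_zero]; exact J.zero_mem
        smul_mem' := fun r y hy x hx => by
          rw [smul_eq_mul, ← mul_assoc]; exact hy _ (J₁.mul_mem_right _ hx) }
    have hJ₂ : J₂.IsTwoSided := ⟨fun {y} r hy x hx => by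
      rw [← mul_assoc]; exact J.mul_mem_right _ (hy x hx)⟩
    have h₁ : J < J₁ := lt_of_le_of_ne
      (fun x hx c => J.mul_mem_right _ (J.mul_mem_right _ hx)) fun h => ha (h ▸ hab)
    have h₂ : J < J₂ := lt_of_le_of_ne (fun y hy x _ => J.mul_mem_left _ hy) fun h => hb
      (h ▸ fun x hx => by simpa using hx 1)
    obtain ⟨k₁, hk₁⟩ := ih J₁ h₁ hJ₁
    obtain ⟨k₂, hk₂⟩ := ih J₂ h₂ hJ₂
    refine ⟨max k₁ k₂ + 1, fun m => (hmul _).trans (Submodule.smul_le.2 fun x hx y hy => ?_)⟩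
    obtain ⟨a₁, ha₁, b₁, hb₁, rfl⟩ :=
      Submodule.mem_sup.1 (hk₁ m (hanti (le_max_left k₁ k₂) hx))
    obtain ⟨a₂, ha₂, b₂, hb₂, rfl⟩ :=
      Submodule.mem_sup.1 (hk₂ m (hanti ((le_max_right k₁ k₂).trans (Nat.le_succ _)) hy))
    have hIm := hI m
    rw [smul_eq_mul, add_mul, mul_add b₁, ← add_assoc]
    exact Submodule.add_mem_sup ((I m).add_mem ((I m).mul_mem_right _ ha₁)
      ((I m).mul_mem_left _ ha₂)) (hb₂ b₁ hb₁)

end Chains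

/-! ### The ideal of a projective module; existence of big lifts. -/

section FairSize

variable {A : Type u} [Ring A]

/-- Only finitely many dual basis coordinates are nonzero on the generators of `X`, and `Y` adjoins
the corresponding basis elements. The other coordinate functionals kill `X`, so their values lie in
`tr(P/X)`. Expanding `p` in the dual basis gives both the product formula and `Y + tr(P/X) P = P`.
-/
theorem exists_traceOf_quotient_le_mul {P : Type u} [AddCommGroup P] [Module A P]
    [Module.Projective A P] {X : Submodule A P} (hX : X.FG) :
    ∃ Y : Submodule A P, Y.FG ∧ X ≤ Y ∧
      traceOf A (P ⧸ Y) ≤ traceOf A (P ⧸ X) * traceOf A (P ⧸ Y) ∧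
      Y ⊔ traceOf A (P ⧸ X) • ⊤ = ⊤ := by
  classical
  obtain ⟨s, hs⟩ := Module.projective_def'.1 ‹Module.Projective A P›
  have hsum : ∀ p, (s p).sum (fun q a => a • q) = p := fun p => LinearMap.congr_fun hs p
  obtain ⟨t, rfl⟩ := hX
  let S : Finset P := t.biUnion fun x => (s x).support
  have hS : ∀ q ∉ S, ∀ p, s p q ∈ traceOf A (P ⧸ Submodule.span A (t : Set P)) := by
    intro q hq p
    refine apply_mem_traceOf_quotient (Finsupp.lapply q ∘ₗ s) (Submodule.span_le.2 fun x hx => ?_) p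
    by_contra h
    exact hq (Finset.mem_biUnion.2 ⟨x, hx, Finsupp.mem_support_iff.2 h⟩)
  refine ⟨Submodule.span A t ⊔ Submodule.span A S, Submodule.FG.sup ⟨t, rfl⟩ ⟨S, rfl⟩,
    le_sup_left, traceOf_quotient_le fun g hg p => ?_, eq_top_iff.2 fun p _ => ?_⟩
  · rw [← hsum p, Finsupp.sum, map_sum]
    refine Submodule.sum_mem _ fun q _ => ?_
    rw [map_smul]
    by_cases hq : q ∈ S
    · have : g q = 0 := hg (Submodule.mem_sup_right (Submodule.subset_span hq))
      rw [this, smul_zero]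
      exact Submodule.zero_mem _
    · exact Ideal.mul_mem_mul (hS q hq p) (apply_mem_traceOf_quotient g hg q)
  · rw [← hsum p]
    refine Submodule.sum_mem _ fun q _ => ?_
    by_cases hq : q ∈ S
    · exact Submodule.mem_sup_left (Submodule.smul_mem _ _
        (Submodule.mem_sup_right (Submodule.subset_span hq)))
    · exact Submodule.mem_sup_right (Submodule.smul_mem_smul (hS q hq p) trivial)

/-- The traces of the modules `P ⧸ X`, with `X` finitely generated, have a smallest element. -/
theorem exists_idempotent_le_traceOf_quotient (R : Type v) [CommRing R] [IsNoetherianRing R] [Algebra R A]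
    [Module.Finite R A] {P : Type u} [AddCommGroup P] [Module A P] [Module.Projective A P]
    (hP : IsCountablyGen A P) :
    ∃ I : Ideal A, I.IsTwoSided ∧ I * I = I ∧
      (∀ X : Submodule A P, X.FG → I ≤ traceOf A (P ⧸ X)) ∧
      ∃ X : Submodule A P, X.FG ∧ X ⊔ I • ⊤ = ⊤ := by
  obtain ⟨Z, hZm, hZ, hZ'⟩ := hP.exists_monotone_fg
  have step : ∀ (n : ℕ) (X : {X : Submodule A P // X.FG}), ∃ Y : {X : Submodule A P // X.FG},
      X.1 ≤ Y.1 ∧ Z n ≤ Y.1 ∧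
      traceOf A (P ⧸ Y.1) ≤ traceOf A (P ⧸ X.1) * traceOf A (P ⧸ Y.1) ∧
      Y.1 ⊔ traceOf A (P ⧸ X.1) • ⊤ = ⊤ := by
    rintro n ⟨X, hX⟩
    obtain ⟨Y, hY, hXY, h, h'⟩ := exists_traceOf_quotient_le_mul (hX.sup (hZ n))
    have hle : traceOf A (P ⧸ X ⊔ Z n) ≤ traceOf A (P ⧸ X) := traceOf_quotient_antitone le_sup_left
    refine ⟨⟨Y, hY⟩, le_sup_left.trans hXY, le_sup_right.trans hXY,
      h.trans (Ideal.mul_mono_left hle),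
      eq_top_iff.2 (h'.ge.trans (sup_le_sup_left (Submodule.smul_mono hle le_rfl) _))⟩
  choose next h1 h2 h3 h4 using step
  obtain ⟨X, hX⟩ : ∃ X : ℕ → {X : Submodule A P // X.FG}, ∀ n, X (n + 1) = next n (X n) :=
    ⟨fun n => Nat.rec ⟨⊥, Submodule.fg_bot⟩ next n, fun n => rfl⟩
  have h1 : ∀ n, (X n).1 ≤ (X (n + 1)).1 := fun n => hX n ▸ h1 n (X n)
  have h2 : ∀ n, Z n ≤ (X (n + 1)).1 := fun n => hX n ▸ h2 n (X n)
  have h3 : ∀ n, traceOf A (P ⧸ (X (n + 1)).1) ≤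
      traceOf A (P ⧸ (X n).1) * traceOf A (P ⧸ (X (n + 1)).1) := fun n => by
    rw [hX n]; exact h3 n (X n)
  have h4 : ∀ n, (X (n + 1)).1 ⊔ traceOf A (P ⧸ (X n).1) • ⊤ = ⊤ := fun n => by
    rw [hX n]; exact h4 n (X n)
  have hXm : Monotone fun n => (X n).1 := monotone_nat_of_le_succ h1
  have hanti : Antitone fun n => traceOf A (P ⧸ (X n).1) := fun m n hmn =>
    traceOf_quotient_antitone (hXm hmn)
  obtain ⟨k, hk⟩ := exists_forall_le_sup (R := R) (fun n => traceOf A (P ⧸ (X n).1))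
    (fun _ => inferInstance) hanti h3 ⊥ inferInstance
  simp only [sup_bot_eq] at hk
  refine ⟨traceOf A (P ⧸ (X k).1), inferInstance, le_antisymm Ideal.mul_le_right ?_, ?_,
    (X (k + 1)).1, (X (k + 1)).2, h4 k⟩
  -- With `I k` the stationary value, `I k ≤ I (k+1) ≤ I k * I (k+1) ≤ I k * I k`.
  · exact (hk (k + 1)).trans ((h3 k).trans (Ideal.mul_mono_right (hanti (Nat.le_succ k))))
  · rintro _ ⟨t, rfl⟩
    choose N hN using hZ'
    have hle : Submodule.span A (t : Set P) ≤ (X (t.sup N + 1)).1 := by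
      refine (Submodule.span_le.2 fun x hx => ?_).trans (h2 (t.sup N))
      exact hZm (Finset.le_sup hx) (hN x)
    exact (hk _).trans (traceOf_quotient_antitone hle)

/-- Two-sided ideals of a module-finite algebra are finitely generated as right ideals. -/
theorem exists_right_generators (R : Type v) [CommRing R] [IsNoetherianRing R] [Algebra R A]
    [Module.Finite R A] (I : Ideal A) [I.IsTwoSided] :
    ∃ (m : ℕ) (x : Fin m → A), (∀ j, x j ∈ I) ∧
      ∀ a ∈ I, ∃ c : Fin m → A, a = ∑ j, x j * c j := by
  have : IsNoetherian R A := isNoetherian_of_isNoetherianRing_of_finite R A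
  obtain ⟨m, x, hx⟩ := Submodule.fg_iff_exists_fin_generating_family.1
    (IsNoetherian.noetherian (I.restrictScalars R))
  refine ⟨m, x, fun j => ?_, fun a ha => ?_⟩
  · have : x j ∈ I.restrictScalars R := hx ▸ Submodule.subset_span ⟨j, rfl⟩
    exact this
  · have ha : a ∈ Submodule.span R (Set.range x) := hx ▸ ha
    obtain ⟨c, rfl⟩ := (Submodule.mem_span_range_iff_exists_fun R).1 ha
    exact ⟨fun j => algebraMap R A (c j), Finset.sum_congr rfl fun j _ => by
      rw [Algebra.smul_def, Algebra.commutes]⟩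

/-- Idempotent ideals are traces of countably generated projective modules. -/
theorem exists_traceOf_eq (R : Type v) [CommRing R] [IsNoetherianRing R] [Algebra R A]
    [Module.Finite R A] (I : Ideal A) [I.IsTwoSided] (hI : I * I = I) :
    ∃ W : ModuleCat.{u} A, IsCountablyGen A W ∧ Module.Projective A W ∧ traceOf A W = I := by
  obtain ⟨m, x, hxI, hx⟩ := exists_right_generators R I
  -- The zero module is presented as a summand of rank `1`, not `0`: then `W = IW` bounds the trace
  -- above by `I`, and `n > 0` bounds it below.
  obtain ⟨W, hW, hW', ⟨e⟩, h⟩ := exists_projective_lift hI hxI hx (n := 1) PUnit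
    ⟨0, 0, LinearMap.ext fun _ => rfl⟩
  refine ⟨W, hW, hW', le_antisymm (traceOf_le_of_smul_top I (eq_top_iff.2 fun w _ => ?_))
    (h one_pos)⟩
  exact mem_smul_top_of_mkQ_eq_zero (e.injective (Subsingleton.elim _ _))

/-- Every countably generated projective module is big relative to a trace ideal modulo which it is
finitely generated. -/
theorem exists_isBig (R : Type v) [CommRing R] [IsNoetherianRing R] [Algebra R A]
    [Module.Finite R A] {P : Type u} [AddCommGroup P] [Module A P] [Module.Projective A P]
    (hP : IsCountablyGen A P) :
    ∃ I : TraceIdeals A, IsBig I.ideal P ∧ ∃ X : Submodule A P, X.FG ∧ X ⊔ I.ideal • ⊤ = ⊤ := by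
  have : IsNoetherianRing A := IsNoetherianRing.of_finite R A
  obtain ⟨I, hI, hII, hIP, h⟩ := exists_idempotent_le_traceOf_quotient R hP
  exact ⟨⟨I, exists_traceOf_eq R I hII⟩, isBig_of_le_traceOf_quotient hP hIP, h⟩

/-- Finitely generated projective modules modulo a trace ideal lift to relatively big projective
modules. -/
theorem exists_isBig_lift (R : Type v) [CommRing R] [IsNoetherianRing R] [Algebra R A]
    [Module.Finite R A] (I : TraceIdeals A) (n : ℕ) (Q : Type u) [AddCommGroup Q]
    [Module (A ⧸ I.ideal) Q] (hQ : IsSummand (A ⧸ I.ideal) Q (Fin n → A ⧸ I.ideal)) :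
    ∃ P : ModuleCat.{u} A, IsCountablyGen A P ∧ Module.Projective A P ∧ IsBig I.ideal P ∧
      Nonempty ((P ⧸ I.ideal • (⊤ : Submodule A P)) ≃ₗ[A ⧸ I.ideal] Q) := by
  have : IsNoetherianRing A := IsNoetherianRing.of_finite R A
  obtain ⟨W, hW, hWp, hWI⟩ := I.2
  change traceOf A W = I.ideal at hWI
  have hII : I.ideal * I.ideal = I.ideal := hWI ▸ traceOf_mul_self
  have hW' : I.ideal • (⊤ : Submodule A (ℕ →₀ W)) = ⊤ :=
    finsupp_smul_top _ (hWI ▸ traceOf_smul_top)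
  obtain ⟨m, x, hxI, hx⟩ := exists_right_generators R I.ideal
  obtain ⟨L, hL, hLp, ⟨e⟩, -⟩ := exists_projective_lift hII hxI hx Q hQ
  have hc : IsCountablyGen A (L × (ℕ →₀ W)) := hL.prod (hW.finsupp ℕ)
  -- The summand `W^(ℕ)` makes the lift `L` big and vanishes modulo `I`.
  refine ⟨ModuleCat.of A (L × (ℕ →₀ W)), hc,
    inferInstanceAs (Module.Projective A (L × (ℕ →₀ W))), ?_, ?_⟩
  · refine isBig_of_le_traceOf_quotient hc fun X hX => hWI ▸ ?_
    exact traceOf_le_traceOf_quotient (f := LinearMap.snd A L (ℕ →₀ W))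
      LinearMap.snd_surjective hX
  · refine nonempty_quotient_smul_equiv (P := L × (ℕ →₀ W)) (e.toAddMonoidHom.comp
      ((Submodule.mkQ _).toAddMonoidHom.comp (AddMonoidHom.fst L (ℕ →₀ W)))) (fun a z => ?_)
      (fun q => ?_) fun z hz => ?_
    · exact e.map_smul (Ideal.Quotient.mk _ a) (Submodule.Quotient.mk z.1)
    · obtain ⟨y, hy⟩ := e.surjective q
      obtain ⟨l, rfl⟩ := Submodule.Quotient.mk_surjective _ y
      exact ⟨(l, 0), hy⟩
    · have h1 : z.1 ∈ I.ideal • (⊤ : Submodule A L) :=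
        mem_smul_top_of_mkQ_eq_zero (e.injective (hz.trans (map_zero e).symm))
      have h2 : z.2 ∈ I.ideal • (⊤ : Submodule A (ℕ →₀ W)) := by rw [hW']; trivial
      exact mem_smul_top_prod h1 h2

end FairSize

/-! ### Finite generation modulo an ideal. -/

section Quotients

variable {A : Type u} [Ring A] {I : Ideal A} [I.IsTwoSided] {P : Type u} [AddCommGroup P]
  [Module A P]

/-- Projectivity of `P` lifts the map `P → P/IP` along a surjection `(A/I)ⁿ → P/IP`. The lift kills
`IP` and so induces a splitting. -/
theorem exists_isSummand_quotient [Module.Projective A P]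
    (h : ∃ X : Submodule A P, X.FG ∧ X ⊔ I • ⊤ = ⊤) :
    MemFinAdd (A ⧸ I) (A ⧸ I) (P ⧸ I • (⊤ : Submodule A P)) := by
  obtain ⟨X, hX, hXI⟩ := h
  have hfin : Module.Finite A (P ⧸ I • (⊤ : Submodule A P)) := by
    refine ⟨?_⟩
    have h1 := hX.map (I • (⊤ : Submodule A P)).mkQ
    rwa [(Submodule.map_mkQ_eq_top _ _).2 (by rwa [sup_comm])] at h1
  have hfin' : Module.Finite (A ⧸ I) (P ⧸ I • (⊤ : Submodule A P)) :=
    Module.Finite.of_restrictScalars_finite A _ _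
  obtain ⟨n, f, hf⟩ := Module.Finite.exists_fin' (A ⧸ I) (P ⧸ I • (⊤ : Submodule A P))
  obtain ⟨g, hg⟩ := Module.projective_lifting_property (f.restrictScalars A)
    (I • (⊤ : Submodule A P)).mkQ hf
  have hgI : I • (⊤ : Submodule A P) ≤ LinearMap.ker g := Submodule.smul_le.2 fun a ha p _ => by
    rw [LinearMap.mem_ker, map_smul]
    ext i
    have hi : (a • g p) i = Ideal.Quotient.mk I a * g p i := rfl
    rw [hi, Ideal.Quotient.eq_zero_iff_mem.2 ha, zero_mul, Pi.zero_apply]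
  let k : (P ⧸ I • (⊤ : Submodule A P)) →ₗ[A ⧸ I] (Fin n → A ⧸ I) :=
    { Submodule.liftQ _ g hgI with
      map_smul' := fun a z => by
        obtain ⟨a, rfl⟩ := Ideal.Quotient.mk_surjective a
        exact (Submodule.liftQ _ g hgI).map_smul a z }
  refine ⟨n, k, f, LinearMap.ext fun z => ?_⟩
  obtain ⟨p, rfl⟩ := Submodule.Quotient.mk_surjective _ z
  exact LinearMap.congr_fun hg p

theorem exists_fg_sup_smul_top (h : MemFinAdd (A ⧸ I) (A ⧸ I) (P ⧸ I • (⊤ : Submodule A P))) :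
    ∃ X : Submodule A P, X.FG ∧ X ⊔ I • ⊤ = ⊤ := by
  classical
  obtain ⟨n, i, p, hpi⟩ := h
  have h1 : Module.Finite (A ⧸ I) (P ⧸ I • (⊤ : Submodule A P)) :=
    Module.Finite.of_surjective p fun z => ⟨i z, LinearMap.congr_fun hpi z⟩
  have h2 : Module.Finite A (P ⧸ I • (⊤ : Submodule A P)) := Module.Finite.trans (A ⧸ I) _
  obtain ⟨s, hs⟩ := h2.fg_top
  obtain ⟨t, -, ht⟩ := Finset.subset_set_image_iff.1
    (show (s : Set (P ⧸ I • (⊤ : Submodule A P))) ⊆ (I • (⊤ : Submodule A P)).mkQ '' Set.univ by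
      rw [Set.image_univ, Set.range_eq_univ.2 (Submodule.mkQ_surjective _)]
      exact Set.subset_univ _)
  refine ⟨Submodule.span A t, ⟨t, rfl⟩, ?_⟩
  rw [sup_comm, ← Submodule.map_mkQ_eq_top, Submodule.map_span, ← hs, ← ht, Finset.coe_image]

end Quotients

/-! ### The functor `Hom(M, -)` on `Add(M)`. -/

section HomFunctor

/-- Shortcut which makes all semiring structures on `EndOp R M` come from the ring structure. -/
instance (priority := 2000) endOpSemiring (R : Type v) [Ring R] (M : Type u) [AddCommGroup M]
    [Module R M] : Semiring (EndOp R M) := Ring.toSemiring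

/-- Shortcut which makes all semiring structures on `EndOp R M` come from the ring structure. -/
instance (priority := 2000) endOpNonAssocSemiring (R : Type v) [Ring R] (M : Type u)
    [AddCommGroup M] [Module R M] : NonAssocSemiring (EndOp R M) := Semiring.toNonAssocSemiring

variable {R : Type v} [Ring R] {M : Type u} [AddCommGroup M] [Module R M]
  {X Y : Type u} [AddCommGroup X] [Module R X] [AddCommGroup Y] [Module R Y]

theorem endOp_smul_apply (a : EndOp R M) (g : M →ₗ[R] X) (x : M) :
    (a • g) x = g (DomMulAct.mk.symm a x) := rfl

/-- Composition with a homomorphism, as a map of right `End M`-modules. -/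
def homMap (h : X →ₗ[R] Y) : (M →ₗ[R] X) →ₗ[EndOp R M] (M →ₗ[R] Y) where
  toFun g := h ∘ₗ g
  map_add' g g' := LinearMap.comp_add g g' h
  map_smul' _ _ := rfl

@[simp] theorem homMap_apply (h : X →ₗ[R] Y) (g : M →ₗ[R] X) : homMap h g = h ∘ₗ g := rfl

theorem IsSummand.trans {A : Type v} [Ring A] {N L K : Type u} [AddCommGroup N] [Module A N]
    [AddCommGroup L] [Module A L] [AddCommGroup K] [Module A K] (h : IsSummand A N L)
    (h' : IsSummand A L K) : IsSummand A N K := by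
  obtain ⟨i, p, h⟩ := h
  obtain ⟨i', p', h'⟩ := h'
  refine ⟨i' ∘ₗ i, p ∘ₗ p', LinearMap.ext fun x => ?_⟩
  have h1 : ∀ x, p (i x) = x := fun x => LinearMap.congr_fun h x
  have h2 : ∀ x, p' (i' x) = x := fun x => LinearMap.congr_fun h' x
  simp [h1, h2]

theorem isSummand_homMap (h : IsSummand R X Y) :
    IsSummand (EndOp R M) (M →ₗ[R] X) (M →ₗ[R] Y) := by
  obtain ⟨i, p, h⟩ := h
  refine ⟨homMap i, homMap p, LinearMap.ext fun g => ?_⟩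
  change p ∘ₗ i ∘ₗ g = g
  rw [← LinearMap.comp_assoc, h, LinearMap.id_comp]

/-- A homomorphism from a finitely generated module to a direct sum is a finite sum of its
components. -/
theorem eq_sum_single_smul [Module.Finite R M] {ι : Type*} (g : M →ₗ[R] (ι →₀ M)) :
    ∃ s : Finset ι, g = ∑ j ∈ s,
      (DomMulAct.mk (Finsupp.lapply j ∘ₗ g : Module.End R M)) •
        (Finsupp.lsingle j : M →ₗ[R] (ι →₀ M)) := by
  classical
  obtain ⟨t, ht⟩ := Module.Finite.fg_top (R := R) (M := M)
  refine ⟨t.biUnion fun x => (g x).support, LinearMap.ext_on ht fun x hx => ?_⟩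
  rw [LinearMap.sum_apply]
  conv_lhs => rw [← Finsupp.sum_single (g x)]
  exact Finsupp.sum_of_support_subset _
    (Finset.subset_biUnion_of_mem (fun x => (g x).support) hx) _ fun i _ => Finsupp.single_zero i

/-- The isomorphism of `Hom(M, ⨁ M)` with a free module. -/
noncomputable def finsuppHom (R : Type v) [Ring R] (M : Type u) [AddCommGroup M] [Module R M]
    (ι : Type*) : (ι →₀ EndOp R M) →ₗ[EndOp R M] (M →ₗ[R] (ι →₀ M)) :=
  Finsupp.linearCombination (EndOp R M) fun j => Finsupp.lsingle j

theorem finsuppHom_apply {ι : Type*} (c : ι →₀ EndOp R M) (x : M) (j : ι) :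
    finsuppHom R M ι c x j = DomMulAct.mk.symm (c j) x := by
  induction c using Finsupp.induction_linear with
  | zero => simp; rfl
  | add c d hc hd =>
    rw [map_add, LinearMap.add_apply, Finsupp.add_apply, hc, hd, Finsupp.add_apply]
    rfl
  | single k a =>
    classical
    rw [finsuppHom, Finsupp.linearCombination_single]
    change Finsupp.single k (DomMulAct.mk.symm a x) j = _
    rw [Finsupp.single_apply, Finsupp.single_apply]
    split_ifs <;> rfl

theorem finsuppHom_bijective [Module.Finite R M] (ι : Type*) :
    Function.Bijective (finsuppHom R M ι) := by
  constructor
  · refine (injective_iff_map_eq_zero _).2 fun c hc => Finsupp.ext fun j => ?_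
    refine DomMulAct.mk.symm.injective (LinearMap.ext fun x => ?_)
    rw [← finsuppHom_apply, hc]
    rfl
  · intro g
    obtain ⟨s, hs⟩ := eq_sum_single_smul g
    refine ⟨∑ j ∈ s, Finsupp.single j (DomMulAct.mk (Finsupp.lapply j ∘ₗ g)), ?_⟩
    rw [map_sum]
    conv_rhs => rw [hs]
    exact Finset.sum_congr rfl fun j _ => Finsupp.linearCombination_single _ _ _

/-- `Hom(M, X)` is countably generated and projective when `X` is a countably generated module in
`Add(M)`. -/
theorem MemAdd.projective_hom [Module.Finite R M] (h : MemAdd R M X) :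
    Module.Projective (EndOp R M) (M →ₗ[R] X) := by
  obtain ⟨ι, h⟩ := h
  obtain ⟨i, p, hip⟩ := isSummand_homMap (M := M) h
  have : Module.Projective (EndOp R M) (M →ₗ[R] (ι →₀ M)) :=
    Module.Projective.of_equiv (LinearEquiv.ofBijective _ (finsuppHom_bijective ι))
  exact Module.Projective.of_split i p hip

theorem MemAdd.isCountablyGen_hom [Module.Finite R M] (h : MemAdd R M X)
    (hX : IsCountablyGen R X) : IsCountablyGen (EndOp R M) (M →ₗ[R] X) := by
  obtain ⟨ι, i, p, hip⟩ := h
  have hip' : ∀ x, p (i x) = x := fun x => LinearMap.congr_fun hip x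
  obtain ⟨s, hs, hsX⟩ := hX
  -- Countably many generators of `X` involve only countably many copies of `M`, and the components
  -- of `p` on those copies generate `Hom(M, X)`.
  let J : Set ι := ⋃ x ∈ s, ((i x).support : Set ι)
  have hJ : J.Countable := hs.biUnion fun x _ => (i x).support.countable_toSet
  have hzero : ∀ j ∉ J, ∀ x, i x j = 0 := by
    intro j hj x
    have hle : Submodule.span R s ≤ LinearMap.ker (Finsupp.lapply (R := R) (M := M) j ∘ₗ i) := by
      refine Submodule.span_le.2 fun y hy => ?_
      by_contra hne
      exact hj (Set.mem_biUnion hy (Finsupp.mem_support_iff.2 hne))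
    have hx : x ∈ Submodule.span R s := hsX ▸ trivial
    exact hle hx
  refine ⟨(fun j => p ∘ₗ Finsupp.lsingle j) '' J, hJ.image _, eq_top_iff.2 fun g _ => ?_⟩
  obtain ⟨t, ht⟩ := eq_sum_single_smul (i ∘ₗ g)
  have hg : g = homMap p (i ∘ₗ g) := LinearMap.ext fun x => (hip' (g x)).symm
  rw [hg, ht, map_sum]
  refine Submodule.sum_mem _ fun j _ => ?_
  rw [map_smul]
  by_cases hj : j ∈ J
  · exact Submodule.smul_mem _ _ (Submodule.subset_span ⟨j, hj, rfl⟩)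
  · have h0 : (Finsupp.lapply j ∘ₗ i ∘ₗ g : Module.End R M) = 0 :=
      LinearMap.ext fun x => hzero j hj (g x)
    rw [h0]
    convert Submodule.zero_mem _
    refine LinearMap.ext fun x => ?_
    rw [endOp_smul_apply]
    exact map_zero _

/-- `Hom(M, -)` is full on `Add(M)`. -/
theorem MemAdd.exists_homMap_eq [Module.Finite R M] (h : MemAdd R M X)
    (F : (M →ₗ[R] X) →ₗ[EndOp R M] (M →ₗ[R] Y)) : ∃ f : X →ₗ[R] Y, homMap f = F := by
  obtain ⟨ι, i, p, hip⟩ := h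
  -- The components of `p` generate `Hom(M, X)` over the endomorphism ring, so `F` is determined by
  -- its values on them; these values assemble to a map out of the direct sum.
  let k : (ι →₀ M) →ₗ[R] Y := Finsupp.lsum ℕ fun j => F (p ∘ₗ Finsupp.lsingle j)
  have hk : ∀ j, k ∘ₗ Finsupp.lsingle j = F (p ∘ₗ Finsupp.lsingle j) := fun j =>
    LinearMap.ext fun x => by simp [k]
  refine ⟨k ∘ₗ i, LinearMap.ext fun g => ?_⟩
  obtain ⟨t, ht⟩ := eq_sum_single_smul (i ∘ₗ g)
  have hg : g = homMap p (i ∘ₗ g) := by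
    rw [homMap_apply, ← LinearMap.comp_assoc, hip, LinearMap.id_comp]
  calc homMap (k ∘ₗ i) g = homMap k (i ∘ₗ g) := rfl
    _ = F (homMap p (i ∘ₗ g)) := by
      rw [ht, map_sum, map_sum, map_sum]
      refine Finset.sum_congr rfl fun j _ => ?_
      rw [map_smul, map_smul, map_smul, homMap_apply, homMap_apply, hk]
    _ = F g := by rw [← hg]

/-- `Hom(M, -)` is faithful on `Add(M)`. -/
theorem MemAdd.eq_of_homMap_eq (h : MemAdd R M X) {f g : X →ₗ[R] Y}
    (hfg : homMap (M := M) f = homMap g) : f = g := by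
  obtain ⟨ι, i, p, hip⟩ := h
  have h1 : f ∘ₗ p = g ∘ₗ p := Finsupp.lhom_ext' fun j => by
    rw [LinearMap.comp_assoc, LinearMap.comp_assoc]
    exact LinearMap.congr_fun hfg (p ∘ₗ Finsupp.lsingle j)
  rw [← LinearMap.comp_id f, ← LinearMap.comp_id g, ← hip, ← LinearMap.comp_assoc, h1,
    LinearMap.comp_assoc]

theorem homMap_comp {Z : Type u} [AddCommGroup Z] [Module R Z] (g : Y →ₗ[R] Z) (f : X →ₗ[R] Y) :
    homMap (M := M) (g ∘ₗ f) = homMap g ∘ₗ homMap f := rfl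

theorem homMap_id : homMap (M := M) (LinearMap.id : X →ₗ[R] X) = LinearMap.id := rfl

theorem MemAdd.isSummand_of_isSummand_hom [Module.Finite R M] (hX : MemAdd R M X)
    (hY : MemAdd R M Y) (h : IsSummand (EndOp R M) (M →ₗ[R] X) (M →ₗ[R] Y)) :
    IsSummand R X Y := by
  obtain ⟨F, G, hFG⟩ := h
  obtain ⟨f, rfl⟩ := hX.exists_homMap_eq F
  obtain ⟨g, rfl⟩ := hY.exists_homMap_eq G
  exact ⟨f, g, hX.eq_of_homMap_eq hFG⟩

theorem MemAdd.nonempty_equiv_of_hom [Module.Finite R M] (hX : MemAdd R M X) (hY : MemAdd R M Y)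
    (e : (M →ₗ[R] X) ≃ₗ[EndOp R M] (M →ₗ[R] Y)) : Nonempty (X ≃ₗ[R] Y) := by
  obtain ⟨f, hf⟩ := hX.exists_homMap_eq e.toLinearMap
  obtain ⟨g, hg⟩ := hY.exists_homMap_eq e.symm.toLinearMap
  refine ⟨LinearEquiv.ofLinearMap f g (hY.eq_of_homMap_eq ?_) (hX.eq_of_homMap_eq ?_)⟩
  · rw [homMap_comp, hf, hg, homMap_id]
    exact LinearMap.ext fun x => e.apply_symm_apply x
  · rw [homMap_comp, hf, hg, homMap_id]
    exact LinearMap.ext fun x => e.symm_apply_apply x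

/-- Every countably generated projective module over `End M` is `Hom(M, X)` for a countably
generated module `X` in `Add(M)`. -/
theorem exists_hom_equiv [Module.Finite R M] {P : Type u} [AddCommGroup P] [Module (EndOp R M) P]
    [Module.Projective (EndOp R M) P] (hP : IsCountablyGen (EndOp R M) P) :
    ∃ X : ModuleCat.{u} R, IsCountablyGen R X ∧ MemAdd R M X ∧
      Nonempty ((M →ₗ[R] X) ≃ₗ[EndOp R M] P) := by
  let ι : Type u := ULift ℕ
  obtain ⟨x, hx⟩ := hP.exists_seq
  have hfree : MemAdd R M (ι →₀ M) := ⟨ι, LinearMap.id, LinearMap.id, rfl⟩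
  let ε := LinearEquiv.ofBijective _ (finsuppHom_bijective (R := R) (M := M) ι)
  let q : (M →ₗ[R] (ι →₀ M)) →ₗ[EndOp R M] P :=
    Finsupp.linearCombination (EndOp R M) (fun j : ι => x j.down) ∘ₗ ε.symm.toLinearMap
  have hq : Function.Surjective q := by
    rw [← LinearMap.range_eq_top, LinearMap.range_comp, LinearEquiv.range, Submodule.map_top,
      Finsupp.range_linearCombination, ← hx]
    congr 1
    exact Equiv.ulift.surjective.range_comp x
  obtain ⟨s, hs⟩ := Module.projective_lifting_property q LinearMap.id hq
  have hs' : ∀ y, q (s y) = y := fun y => LinearMap.congr_fun hs y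
  -- By fullness and faithfulness, the idempotent `s ∘ q` with image isomorphic to `P` comes from an
  -- idempotent `e` on the direct sum of copies of `M`; the module sought is the range of `e`.
  obtain ⟨e, he⟩ := hfree.exists_homMap_eq (s ∘ₗ q)
  have he' : ∀ g : M →ₗ[R] (ι →₀ M), e ∘ₗ g = s (q g) := fun g => LinearMap.congr_fun he g
  have hee : e ∘ₗ e = e := hfree.eq_of_homMap_eq (M := M) (by
    rw [homMap_comp, he]
    exact LinearMap.ext fun g => by simp [hs'])
  have hee' : ∀ y, e (e y) = e y := fun y => LinearMap.congr_fun hee y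
  have hadd : MemAdd R M (LinearMap.range e) := by
    refine ⟨ι, (LinearMap.range e).subtype, e.rangeRestrict, LinearMap.ext ?_⟩
    rintro ⟨_, y, rfl⟩
    exact Subtype.ext (hee' y)
  refine ⟨ModuleCat.of R (LinearMap.range e), ?_, hadd, ?_⟩
  · exact ((IsCountablyGen.of_finite (A := R) (P := M)).finsupp ι).of_surjective e.rangeRestrict
      e.surjective_rangeRestrict
  · refine ⟨LinearEquiv.ofBijective (q ∘ₗ homMap (LinearMap.range e).subtype) ⟨?_, fun y => ?_⟩⟩
    · refine (injective_iff_map_eq_zero _).2 fun g hg => LinearMap.ext fun m => Subtype.ext ?_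
      have h0 : q ((LinearMap.range e).subtype ∘ₗ g) = 0 := hg
      have h1 := he' ((LinearMap.range e).subtype ∘ₗ g)
      rw [h0, map_zero] at h1
      obtain ⟨y, hy⟩ := (g m).2
      have h2 : e (g m).1 = 0 := LinearMap.congr_fun h1 m
      rw [← hy, hee', hy] at h2
      exact h2
    · refine ⟨e.rangeRestrict ∘ₗ s y, ?_⟩
      have h1 : (LinearMap.range e).subtype ∘ₗ e.rangeRestrict ∘ₗ s y = e ∘ₗ s y := rfl
      change q ((LinearMap.range e).subtype ∘ₗ e.rangeRestrict ∘ₗ s y) = y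
      rw [h1, he', hs', hs']

/-- Composition with an isomorphism, as an isomorphism of right `End M`-modules. -/
def homEquiv (e : X ≃ₗ[R] Y) : (M →ₗ[R] X) ≃ₗ[EndOp R M] (M →ₗ[R] Y) :=
  { (homMap e.toLinearMap : (M →ₗ[R] X) →ₗ[EndOp R M] (M →ₗ[R] Y)) with
    invFun := fun g => e.symm.toLinearMap ∘ₗ g
    left_inv := fun g => LinearMap.ext fun x => e.symm_apply_apply (g x)
    right_inv := fun g => LinearMap.ext fun x => e.apply_symm_apply (g x) }

/-- The isomorphism of the free right `End M`-module of rank `n` with `Hom(M, Mⁿ)`. -/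
noncomputable def piHomEquiv [Module.Finite R M] (n : ℕ) :
    (Fin n → EndOp R M) ≃ₗ[EndOp R M] (M →ₗ[R] (Fin n → M)) :=
  ((Finsupp.linearEquivFunOnFinite (EndOp R M) (EndOp R M) (Fin n)).symm.trans
    (LinearEquiv.ofBijective _ (finsuppHom_bijective (R := R) (M := M) (Fin n)))).trans
    (homEquiv (Finsupp.linearEquivFunOnFinite R M (Fin n)))

end HomFunctor

/-! ### Isomorphism invariance and uniqueness of classes. -/

section Classes

variable {A : Type u} [Ring A]

theorem IsSummand.of_equiv {A : Type v} [Ring A] {N L : Type u} [AddCommGroup N] [Module A N]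
    [AddCommGroup L] [Module A L] (e : N ≃ₗ[A] L) : IsSummand A N L :=
  ⟨e.toLinearMap, e.symm.toLinearMap, LinearMap.ext e.symm_apply_apply⟩

theorem MemFinAdd.of_equiv {A : Type v} [Ring A] {M N L : Type u} [AddCommGroup M] [Module A M]
    [AddCommGroup N] [Module A N] [AddCommGroup L] [Module A L] (e : N ≃ₗ[A] L)
    (h : MemFinAdd A M L) : MemFinAdd A M N :=
  h.imp fun _ h => (IsSummand.of_equiv e).trans h

theorem IsBig.of_equiv {I : Ideal A} {P Q : Type u} [AddCommGroup P] [Module A P]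
    [AddCommGroup Q] [Module A Q] (e : P ≃ₗ[A] Q) (h : IsBig I Q) : IsBig I P :=
  fun L hL hLp hLI => by
    obtain ⟨f, hf⟩ := h L hL hLp hLI
    exact ⟨f ∘ₗ e.toLinearMap, hf.comp e.surjective⟩

theorem isoClass_quotient_congr {I : Ideal A} [I.IsTwoSided] {P Q : Type u} [AddCommGroup P]
    [Module A P] [AddCommGroup Q] [Module A Q] (e : P ≃ₗ[A] Q) :
    isoClass (A ⧸ I) (P ⧸ I • (⊤ : Submodule A P)) =
      isoClass (A ⧸ I) (Q ⧸ I • (⊤ : Submodule A Q)) := by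
  refine isoClass_eq_iff.2 (nonempty_quotient_smul_equiv
    ((Submodule.mkQ _).toAddMonoidHom.comp e.toLinearMap.toAddMonoidHom) (fun a z => ?_)
    ((Submodule.mkQ_surjective _).comp e.surjective) fun z hz => ?_)
  · change Submodule.Quotient.mk (e (a • z)) = _
    rw [map_smul]
    rfl
  · have h1 := Submodule.mem_map_of_mem (f := e.symm.toLinearMap) (mem_smul_top_of_mkQ_eq_zero hz)
    rw [Submodule.map_smul''] at h1
    have h2 := Submodule.smul_mono (le_refl I)
      (le_top : Submodule.map e.symm.toLinearMap ⊤ ≤ ⊤) h1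
    have h3 : e.symm (e z) = z := e.symm_apply_apply z
    rw [← h3]
    exact h2

/-- Bigness and the class modulo `I` are isomorphism invariants, so they can be tested on any
representative. -/
theorem iotaRel_iff {I : TraceIdeals A} {q : IsoClass.{u, u} (A ⧸ I.ideal)} {P : Type u}
    [AddCommGroup P] [Module A P] [Module.Projective A P] (hP : IsCountablyGen A P) :
    IotaRel I q (isoClass A P) ↔
      IsBig I.ideal P ∧ isoClass (A ⧸ I.ideal) (P ⧸ I.ideal • (⊤ : Submodule A P)) = q := by
  constructor
  · rintro ⟨Q, hQ, -, -, hb, hq⟩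
    obtain ⟨e⟩ := isoClass_eq_iff.1 hQ
    exact ⟨hb.of_equiv e.symm, (isoClass_quotient_congr e.symm).trans hq⟩
  · rintro ⟨hb, hq⟩
    exact ⟨ModuleCat.of A P, rfl, hP, ‹_›, hb, hq⟩

theorem IotaRel.unique {I : TraceIdeals A} [IsNoetherianRing A] {P Q : Type u} [AddCommGroup P]
    [Module A P] [Module.Projective A P] [AddCommGroup Q] [Module A Q] [Module.Projective A Q]
    (hP : IsCountablyGen A P) (hQ : IsCountablyGen A Q) {q : IsoClass.{u, u} (A ⧸ I.ideal)}
    (hPq : IotaRel I q (isoClass A P)) (hQq : IotaRel I q (isoClass A Q)) :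
    Nonempty (P ≃ₗ[A] Q) := by
  obtain ⟨hPb, hPq⟩ := (iotaRel_iff hP).1 hPq
  obtain ⟨hQb, hQq⟩ := (iotaRel_iff hQ).1 hQq
  obtain ⟨e⟩ := isoClass_eq_iff.1 (hPq.trans hQq.symm)
  obtain ⟨_, W, hW, hWp, rfl⟩ := I
  exact IsBig.nonempty_equiv hW hP hQ hPb hQb e

theorem mem_vMonoid_iff {A : Type v} [Ring A] {M N : Type u} [AddCommGroup M] [Module A M]
    [AddCommGroup N] [Module A N] : isoClass A N ∈ VMonoid A M ↔ MemFinAdd A M N := by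
  constructor
  · rintro ⟨L, hL, h⟩
    obtain ⟨e⟩ := isoClass_eq_iff.1 hL
    exact h.of_equiv e.symm
  · exact fun h => ⟨ModuleCat.of A N, rfl, h⟩

theorem TraceIdeals.ideal_le {I : TraceIdeals A} {J : Ideal A} [J.IsTwoSided] {P : Type u}
    [AddCommGroup P] [Module A P] (hP : IsBig I.ideal P)
    (hJ : ∃ X : Submodule A P, X.FG ∧ X ⊔ J • ⊤ = ⊤) : I.ideal ≤ J := by
  obtain ⟨_, W, hW, hWp, rfl⟩ := I
  exact IsBig.traceOf_le hW hP hJ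

end Classes

/-! ### From projectives over the endomorphism ring back to `M`. -/

section Endomorphisms

variable {R : Type v} [CommRing R] {M : Type u} [AddCommGroup M] [Module R M]

instance endOpAlgebra : Algebra R (EndOp R M) :=
  RingHom.toAlgebra'
    { toFun := fun r => DomMulAct.mk (algebraMap R (Module.End R M) r)
      map_one' := congrArg DomMulAct.mk (map_one _)
      map_mul' := fun r s => congrArg DomMulAct.mk
        ((map_mul (algebraMap R (Module.End R M)) r s).trans (Algebra.commutes r _))
      map_zero' := congrArg DomMulAct.mk (map_zero _)
      map_add' := fun r s => congrArg DomMulAct.mk (map_add _ r s) }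
    fun r a => congrArg DomMulAct.mk (Algebra.commutes r (DomMulAct.mk.symm a)).symm

instance endOp_finite [IsNoetherianRing R] [Module.Finite R M] :
    Module.Finite R (EndOp R M) := by
  have h : Module.Finite R (Module.End R M) := inferInstance
  let f : Module.End R M →ₗ[R] EndOp R M :=
    { toFun := DomMulAct.mk
      map_add' := fun _ _ => rfl
      map_smul' := fun r a => by
        rw [RingHom.id_apply, Algebra.smul_def, Algebra.commutes, Algebra.smul_def]
        rfl }
  exact Module.Finite.of_surjective f DomMulAct.mk.surjective

theorem MemFinAdd.memAdd {X : Type u} [AddCommGroup X] [Module R X] (h : MemFinAdd R M X) :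
    MemAdd R M X := by
  obtain ⟨n, h⟩ := h
  refine ⟨ULift (Fin n), h.trans (IsSummand.of_equiv ?_)⟩
  exact (Finsupp.linearEquivFunOnFinite R M (Fin n)).symm.trans
    (Finsupp.domLCongr Equiv.ulift.symm)

theorem MemFinAdd.isCountablyGen [Module.Finite R M] {X : Type u} [AddCommGroup X] [Module R X]
    (h : MemFinAdd R M X) : IsCountablyGen R X := by
  obtain ⟨n, i, p, hip⟩ := h
  exact (IsCountablyGen.of_finite (A := R) (P := Fin n → M)).of_surjective p fun x =>
    ⟨i x, LinearMap.congr_fun hip x⟩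

theorem memFinAdd_iff_finite_hom [Module.Finite R M] {X : Type u} [AddCommGroup X] [Module R X]
    (hX : MemAdd R M X) :
    MemFinAdd R M X ↔ Module.Finite (EndOp R M) (M →ₗ[R] X) := by
  constructor
  · rintro ⟨n, h⟩
    obtain ⟨i, p, hip⟩ := isSummand_homMap (M := M) h
    have : Module.Finite (EndOp R M) (M →ₗ[R] (Fin n → M)) :=
      Module.Finite.equiv (piHomEquiv n)
    exact Module.Finite.of_surjective p fun x => ⟨i x, LinearMap.congr_fun hip x⟩
  · intro h
    have := hX.projective_hom
    obtain ⟨n, f, hf⟩ := Module.Finite.exists_fin' (EndOp R M) (M →ₗ[R] X)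
    obtain ⟨s, hs⟩ := Module.projective_lifting_property f LinearMap.id hf
    have hn : MemAdd R M (Fin n → M) :=
      MemFinAdd.memAdd ⟨n, LinearMap.id, LinearMap.id, rfl⟩
    exact ⟨n, hX.isSummand_of_isSummand_hom hn
      (IsSummand.trans ⟨s, f, hs⟩ (IsSummand.of_equiv (piHomEquiv n)))⟩

theorem alphaRel_iff [Module.Finite R M] {X : Type u} [AddCommGroup X] [Module R X]
    (hX : IsCountablyGen R X) (hX' : MemAdd R M X) {I : TraceIdeals (EndOp R M)}
    {q : IsoClass.{u, u} (EndOp R M ⧸ I.ideal)} :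
    AlphaRel I q (isoClass R X) ↔ IsBig I.ideal (M →ₗ[R] X) ∧
      isoClass (EndOp R M ⧸ I.ideal)
        ((M →ₗ[R] X) ⧸ I.ideal • (⊤ : Submodule (EndOp R M) (M →ₗ[R] X))) = q := by
  have := hX'.projective_hom
  have hmem : isoClass R X ∈ VStar R M := ⟨ModuleCat.of R X, rfl, hX, hX'⟩
  rw [← iotaRel_iff (hX'.isCountablyGen_hom hX)]
  exact ⟨fun h => h.2, fun h => ⟨hmem, h⟩⟩

/-- Every module in `V*(M)` has an ideal and a class modulo this ideal. -/
theorem exists_alphaRel [IsNoetherianRing R] [Module.Finite R M] {X : Type u} [AddCommGroup X]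
    [Module R X] (hX : IsCountablyGen R X) (hX' : MemAdd R M X) :
    ∃ I : TraceIdeals (EndOp R M), ∃ q ∈ VQuot R M I, AlphaRel I q (isoClass R X) := by
  have := hX'.projective_hom
  obtain ⟨I, hb, h⟩ := exists_isBig R (hX'.isCountablyGen_hom hX)
  exact ⟨I, _, mem_vMonoid_iff.2 (exists_isSummand_quotient h), (alphaRel_iff hX hX').2 ⟨hb, rfl⟩⟩

theorem exists_fg_of_alphaRel [Module.Finite R M] {X : Type u} [AddCommGroup X]
    [Module R X] (hX : IsCountablyGen R X) (hX' : MemAdd R M X) {I : TraceIdeals (EndOp R M)}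
    {q : IsoClass.{u, u} (EndOp R M ⧸ I.ideal)} (hq : q ∈ VQuot R M I)
    (h : AlphaRel I q (isoClass R X)) :
    ∃ Z : Submodule (EndOp R M) (M →ₗ[R] X), Z.FG ∧ Z ⊔ I.ideal • ⊤ = ⊤ := by
  obtain ⟨-, rfl⟩ := (alphaRel_iff hX hX').1 h
  exact exists_fg_sup_smul_top (mem_vMonoid_iff.1 hq)

/-- Bigness relative to `I` is played against finite generation modulo `J`. Exchanging the roles
gives equality of the two ideals. -/
theorem AlphaRel.ideal_le [Module.Finite R M] {X : Type u} [AddCommGroup X]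
    [Module R X] (hX : IsCountablyGen R X) (hX' : MemAdd R M X) {I J : TraceIdeals (EndOp R M)}
    {q : IsoClass.{u, u} (EndOp R M ⧸ I.ideal)} {q' : IsoClass.{u, u} (EndOp R M ⧸ J.ideal)}
    (hq' : q' ∈ VQuot R M J) (h : AlphaRel I q (isoClass R X))
    (h' : AlphaRel J q' (isoClass R X)) : I.ideal ≤ J.ideal :=
  TraceIdeals.ideal_le ((alphaRel_iff hX hX').1 h).1 (exists_fg_of_alphaRel hX hX' hq' h')

theorem memFinAdd_of_alphaRel_bot [Module.Finite R M] {X : Type u} [AddCommGroup X]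
    [Module R X] (hX : IsCountablyGen R X) (hX' : MemAdd R M X) {I : TraceIdeals (EndOp R M)}
    (hI : I.ideal = ⊥) {q : IsoClass.{u, u} (EndOp R M ⧸ I.ideal)} (hq : q ∈ VQuot R M I)
    (h : AlphaRel I q (isoClass R X)) : MemFinAdd R M X := by
  obtain ⟨Z, hZ, hZ'⟩ := exists_fg_of_alphaRel hX hX' hq h
  rw [hI, Submodule.bot_smul, sup_bot_eq] at hZ'
  exact (memFinAdd_iff_finite_hom hX').2 ⟨hZ' ▸ hZ⟩

/-- `Hom(M, X)` is finitely generated, that is, finitely generated modulo the zero ideal, so bigness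
forces `I ≤ 0`. Hence `V(M)` and `B(M)` are disjoint. -/
theorem AlphaRel.eq_bot_of_memFinAdd [Module.Finite R M] {X : Type u} [AddCommGroup X]
    [Module R X] (hX' : MemFinAdd R M X) {I : TraceIdeals (EndOp R M)}
    {q : IsoClass.{u, u} (EndOp R M ⧸ I.ideal)}
    (h : AlphaRel I q (isoClass R X)) : I.ideal = ⊥ := by
  have hfin := (memFinAdd_iff_finite_hom hX'.memAdd).1 hX'
  exact le_bot_iff.1 (TraceIdeals.ideal_le
    ((alphaRel_iff hX'.isCountablyGen hX'.memAdd).1 h).1 ⟨⊤, hfin.fg_top, top_sup_eq _⟩)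

end Endomorphisms

/-! ### The main theorem. -/

theorem mainTheorem5 {R : Type v} [CommRing R] [IsNoetherianRing R]
    (M : Type u) [AddCommGroup M] [Module R M] [Module.Finite R M] :
    -- `V*(M)` is the disjoint union of `V(M)` and `B(M)`
    ((VStar R M : Set (IsoClass.{u, v} R)) = (VMonoid R M : Set (IsoClass.{u, v} R)) ∪ BSet R M ∧
      Disjoint (VMonoid R M : Set (IsoClass.{u, v} R)) (BSet R M)) ∧
    -- every class in `V*(M)` is `α_I(q)` for exactly one trace ideal `I` and one `q` in `V(S/I)`
    (∀ x ∈ VStar R M, ∃! d : (Σ I : TraceIdeals (EndOp R M), VQuot R M I),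
      AlphaRel d.1 (d.2 : IsoClass.{u, u} (EndOp R M ⧸ d.1.ideal)) x) ∧
    -- every such pair `(I, q)` determines exactly one class `α_I(q)` in `V*(M)`
    (∀ (I : TraceIdeals (EndOp R M)) (q : VQuot R M I),
      ∃! x : IsoClass.{u, v} R, AlphaRel I (q : IsoClass.{u, u} (EndOp R M ⧸ I.ideal)) x) := by
  refine ⟨⟨Set.Subset.antisymm ?_ (Set.union_subset ?_ ?_), Set.disjoint_left.2 ?_⟩, ?_, ?_⟩
  · rintro _ ⟨X, rfl, hX, hX'⟩
    obtain ⟨I, q, hq, h⟩ := exists_alphaRel hX hX'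
    by_cases hI : I.ideal = ⊥
    · exact Or.inl (mem_vMonoid_iff.2 (memFinAdd_of_alphaRel_bot hX hX' hI hq h))
    · exact Or.inr ⟨I, hI, q, hq, h⟩
  · rintro _ ⟨X, rfl, hX⟩
    exact ⟨X, rfl, hX.isCountablyGen, hX.memAdd⟩
  · rintro x ⟨I, -, q, -, h⟩
    exact h.1
  · rintro _ ⟨X, rfl, hX⟩ ⟨I, hI, q, -, h⟩
    exact hI (h.eq_bot_of_memFinAdd hX)
  · rintro _ ⟨X, rfl, hX, hX'⟩
    obtain ⟨I, q, hq, h⟩ := exists_alphaRel hX hX'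
    refine ⟨⟨I, q, hq⟩, h, ?_⟩
    rintro ⟨J, q', hq'⟩ h'
    -- The ideals are identified first, since the types of `q` and `q'` depend on them.
    obtain rfl : J = I :=
      Subtype.ext (le_antisymm (AlphaRel.ideal_le hX hX' hq h' h) (AlphaRel.ideal_le hX hX' hq' h h'))
    have : q' = q :=
      ((alphaRel_iff hX hX').1 h').2.symm.trans ((alphaRel_iff hX hX').1 h).2
    subst this
    rfl
  · rintro I ⟨_, N, rfl, n, hN⟩
    have : IsNoetherianRing (EndOp R M) := IsNoetherianRing.of_finite R _
    -- The big lift `P` of `N` is realized as `Hom(M, X)`, and the class of `X` is the required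
    -- value of `α_I`.
    obtain ⟨P, hP, hPp, hPb, ⟨e⟩⟩ := exists_isBig_lift R I n N hN
    obtain ⟨X, hX, hX', ⟨f⟩⟩ := exists_hom_equiv hP
    have hα : AlphaRel I (isoClass _ N) (isoClass R X) :=
      (alphaRel_iff hX hX').2 ⟨hPb.of_equiv f,
        (isoClass_quotient_congr f).trans (isoClass_eq_iff.2 ⟨e⟩)⟩
    refine ⟨isoClass R X, hα, ?_⟩
    rintro y hy
    obtain ⟨Y, rfl, hY, hY'⟩ := hy.1
    have := hX'.projective_hom
    have := hY'.projective_hom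
    obtain ⟨g⟩ := IotaRel.unique (hY'.isCountablyGen_hom hY) (hX'.isCountablyGen_hom hX) hy.2 hα.2
    obtain ⟨k⟩ := hY'.nonempty_equiv_of_hom hX' g
    exact isoClass_eq_iff.2 ⟨k⟩
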